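/- Let $d\ge 1$ and $Q(x)=x_1^2+\cdots+x_d^2$. For integers $N\ge 0$ and $s\in\mathbb{C}$ put $$\alpha_N(s)=\sum_{\substack{n\in\mathbb{Z}^d\setminus\{0\}\\ |n_i|\le N}}\frac{1}{Q(n)^s},\qquad \beta_N(s)=\int_{[-N-\frac12,\,N+\frac12]^d}\frac{dx}{Q(x)^s}\quad(\operatorname{Re}s<d/2),\qquad \sigma_N(s)=\alpha_N(s)-\beta_N(s),$$ where the integrals $\beta_N(s)$ converge absolutely for $\operatorname{Re}s<d/2$. Let $\alpha(s)=\sum_{n\in\mathbb{Z}^d\setminus\{0\}}Q(n)^{-s}$ for $\operatorname{Re}s>d/2$ be the Epstein zeta function of $Q$; it has a meromorphic continuation to $\mathbb{C}$, holomorphic on $\mathbb{C}\setminus\{d/2\}$, also denoted by $\alpha$. Then the limit $\sigma(s):=\lim_{N\to\infty}\sigma_N(s)$ exists for every $s$ in the strip $d/2-1<\operatorname{Re}s<d/2$ and for $s=d/2-1$. In the strip, $\sigma(s)=\alpha(s)$. On the other hand, $$\sigma(d/2-1)-\frac16\,\frac{\pi^{d/2}}{\Gamma(d/2-1)}=\alpha(d/2-1)=\lim_{\varepsilon\to0^+}\sigma(d/2-1+\varepsilon),$$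 where $1/\Gamma(0)$ is read as $0$ when $d=2$. In particular, for $d\ge 3$, the function $\sigma$, on the union of the strip and the point $d/2-1$, is discontinuous at $s=d/2-1$. -/

import Mathlib

open Filter Topology MeasureTheory

noncomputable section

namespace Wigner

/-- The cubic form `Q(x) = x₁² + ⋯ + x_d²`. -/
def cubicForm (d : ℕ) (x : Fin d → ℝ) : ℝ := ∑ i, x i ^ 2

/-- `α_N(s)`: the sum of `1 / Q(n)^s` over the integer vectors `n ≠ 0` with all coordinates
between `-N` and `N`. -/
def alphaN {d : ℕ} (Q : (Fin d → ℝ) → ℝ) (N : ℕ) (s : ℂ) : ℂ :=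
  ∑ n ∈ (Fintype.piFinset fun _ : Fin d => Finset.Icc (-(N : ℤ)) (N : ℤ)).erase 0,
    1 / ((Q fun i => (n i : ℝ)) : ℂ) ^ s

/-- The cube `[-N - 1/2, N + 1/2]^d`. -/
def cube (d N : ℕ) : Set (Fin d → ℝ) :=
  Set.Icc (fun _ => -(N : ℝ) - 1 / 2) (fun _ => (N : ℝ) + 1 / 2)

/-- `β_N(s)`: the integral of `1 / Q(x)^s` over the cube `[-N - 1/2, N + 1/2]^d`. -/
def betaN {d : ℕ} (Q : (Fin d → ℝ) → ℝ) (N : ℕ) (s : ℂ) : ℂ :=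
  ∫ x in cube d N, 1 / (Q x : ℂ) ^ s

/-- `σ_N(s) = α_N(s) - β_N(s)`. -/
def sigmaN {d : ℕ} (Q : (Fin d → ℝ) → ℝ) (N : ℕ) (s : ℂ) : ℂ :=
  alphaN Q N s - betaN Q N s

/-- The Wigner limit `σ(s) = lim_{N → ∞} σ_N(s)` (meaningful where the limit exists). -/
def sigma {d : ℕ} (Q : (Fin d → ℝ) → ℝ) (s : ℂ) : ℂ :=
  limUnder atTop fun N : ℕ => sigmaN Q N s

/-- The open strip `d/2 - 1 < Re s < d/2`. -/
def strip (d : ℕ) : Set ℂ := {s | (d : ℝ) / 2 - 1 < s.re ∧ s.re < (d : ℝ) / 2}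

/-- `α` is the analytic continuation of the Epstein zeta function
`Z_Q(s) = ∑_{n ∈ ℤ^d, n ≠ 0} 1 / Q(n)^s`: it is given by this (absolutely convergent) series for
`Re s > d/2`, it is holomorphic on `ℂ ∖ {d/2}`, and it is meromorphic at `d/2`. These conditions
determine `α` on the connected set `ℂ ∖ {d/2}`. -/
structure IsEpsteinContinuation {d : ℕ} (Q : (Fin d → ℝ) → ℝ) (α : ℂ → ℂ) : Prop where
  hasSum : ∀ s : ℂ, (d : ℝ) / 2 < s.re →
    HasSum (fun n : {n : Fin d → ℤ // n ≠ 0} => 1 / ((Q fun i => (n.1 i : ℝ)) : ℂ) ^ s) (α s)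
  differentiableOn : DifferentiableOn ℂ α {(d : ℂ) / 2}ᶜ
  meromorphicAt : MeromorphicAt α ((d : ℂ) / 2)

end Wigner

end

namespace Wigner

variable {d : ℕ}

/-! Cut the cube into unit cells centred at lattice points and compare `Q(n)^(-s)` with its integral
over the cell of `n`. The cell is symmetric, so odd Taylor terms drop out. The quadratic term
averages to `(1/24) Δ Q^(-s) = (1/6) s (s + 1 - d/2) Q^(-s-1)`, and the rest is `O(|n|^(-2 Re s -
4))` (`norm_cellRemainder_le`). The remainders therefore sum to a function `R(s)` holomorphic for
`Re s > d/2 - 2` (`differentiableAt_remainderSum`).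

Up to the integral over the central cell, `σ_N(s)` is the sum of the cell errors
(`sigmaN_cubicForm`). In the strip this sum tends to `R(s) - (1/6) s (s + 1 - d/2) α(s + 1)`. The
same expression, with the central integral continued in `s`, equals `α(s)` for `Re s > d/2`, and the
identity theorem carries this equality to `Re s > d/2 - 2` (`epsteinEntire_eq`). Hence `σ = α` in
the strip.

At `s = d/2 - 1` the factor `s + 1 - d/2` kills the quadratic term cell by cell, so the errors sum
to `R(s)` alone (`hasSum_cellError_half_dim_sub_one`). In the continuation, however, the zero of
this factor meets the pole of `α(s + 1)` and leaves the residue `π^(d/2) / Γ(d/2)`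
(`epsteinEntire_half_dim`). Multiplied by `(1/6)(d/2 - 1)`, this is the jump. -/

/-! ### Second differences of complex powers of a quadratic polynomial. -/

theorem norm_le_of_hasDerivAt_of_zero {ψ ψ' : ℝ → ℂ} {C : ℝ} (hψ : ψ 0 = 0)
    (hd : ∀ t ∈ Set.Icc (0 : ℝ) 1, HasDerivAt ψ (ψ' t) t)
    (hC : ∀ t ∈ Set.Icc (0 : ℝ) 1, ‖ψ' t‖ ≤ C) : ∀ t ∈ Set.Icc (0 : ℝ) 1, ‖ψ t‖ ≤ C := by
  intro t ht
  have hC0 : 0 ≤ C := (norm_nonneg _).trans (hC t ht)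
  have h := norm_image_sub_le_of_norm_deriv_le_segment'
    (fun x hx => (hd x hx).hasDerivWithinAt) (fun x hx => hC x ⟨hx.1, hx.2.le⟩) t ht
  rw [hψ, sub_zero, sub_zero] at h
  exact h.trans (mul_le_of_le_one_right hC0 ht.2)

/-- Symmetric second difference with a fourth order remainder. -/
theorem norm_second_difference_sub_le {g g1 g2 g3 g4 : ℝ → ℂ} {M : ℝ}
    (h0 : ∀ t ∈ Set.Icc (-1 : ℝ) 1, HasDerivAt g (g1 t) t)
    (h1 : ∀ t ∈ Set.Icc (-1 : ℝ) 1, HasDerivAt g1 (g2 t) t)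
    (h2 : ∀ t ∈ Set.Icc (-1 : ℝ) 1, HasDerivAt g2 (g3 t) t)
    (h3 : ∀ t ∈ Set.Icc (-1 : ℝ) 1, HasDerivAt g3 (g4 t) t)
    (hM : ∀ t ∈ Set.Icc (-1 : ℝ) 1, ‖g4 t‖ ≤ M) :
    ‖g 1 + g (-1) - 2 * g 0 - g2 0‖ ≤ 2 * M := by
  have hp : ∀ t ∈ Set.Icc (0 : ℝ) 1, t ∈ Set.Icc (-1 : ℝ) 1 := fun t ht =>
    ⟨by linarith [ht.1], ht.2⟩
  have hn : ∀ t ∈ Set.Icc (0 : ℝ) 1, -t ∈ Set.Icc (-1 : ℝ) 1 := fun t ht =>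
    ⟨by linarith [ht.2], by linarith [ht.1]⟩
  have hneg : ∀ {k k' : ℝ → ℂ}, (∀ t ∈ Set.Icc (-1 : ℝ) 1, HasDerivAt k (k' t) t) →
      ∀ t ∈ Set.Icc (0 : ℝ) 1, HasDerivAt (fun u => k (-u)) (-k' (-t)) t := by
    intro k k' h t ht
    simpa [Function.comp_def] using (h (-t) (hn t ht)).scomp t (hasDerivAt_neg t)
  -- Each function in the chain `b3`, `b2`, `b1`, `b0` vanishes at `0` and has the previous one as
  -- derivative, so the bound `2 * M` on the derivative of the first passes through all four
  -- integrations over `[0, 1]`. The sharp constant `M / 12` is not needed.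
  have b3 := norm_le_of_hasDerivAt_of_zero (ψ := fun t => g3 t - g3 (-t))
    (ψ' := fun t => g4 t + g4 (-t)) (C := 2 * M) (by simp)
    (fun t ht => by
      simpa [Pi.sub_def] using (h3 t (hp t ht)).sub (hneg h3 t ht))
    (fun t ht => (norm_add_le _ _).trans
      (by linarith [hM t (hp t ht), hM (-t) (hn t ht)]))
  have b2 := norm_le_of_hasDerivAt_of_zero (ψ := fun t => g2 t + g2 (-t) - 2 * g2 0)
    (ψ' := fun t => g3 t - g3 (-t)) (C := 2 * M) (by simp; ring)
    (fun t ht => by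
      simpa [sub_eq_add_neg] using ((h2 t (hp t ht)).add (hneg h2 t ht)).sub_const (2 * g2 0))
    b3
  have b1 := norm_le_of_hasDerivAt_of_zero (ψ := fun t => g1 t - g1 (-t) - t * (2 * g2 0))
    (ψ' := fun t => g2 t + g2 (-t) - 2 * g2 0) (C := 2 * M) (by simp)
    (fun t ht => by
      have h := ((h1 t (hp t ht)).sub (hneg h1 t ht)).sub
        ((Complex.ofRealCLM.hasDerivAt (x := t)).mul_const (2 * g2 0))
      simpa [Pi.sub_def] using h)
    b2
  have b0 := norm_le_of_hasDerivAt_of_zero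
    (ψ := fun t => g t + g (-t) - 2 * g 0 - (t : ℂ) * t * g2 0)
    (ψ' := fun t => g1 t - g1 (-t) - t * (2 * g2 0)) (C := 2 * M) (by simp; ring)
    (fun t ht => by
      have h := (((h0 t (hp t ht)).add (hneg h0 t ht)).sub_const (2 * g 0)).sub
        (((Complex.ofRealCLM.hasDerivAt (x := t)).mul
          (Complex.ofRealCLM.hasDerivAt (x := t))).mul_const (g2 0))
      convert! h using 1
      simp
      ring)
    b1
  simpa using b0 1 (by simp)

theorem rpow_neg_le_mul_rpow_neg {y m L : ℝ} (hm : 0 < m) (hL : 1 ≤ L) (hl : m ^ 2 / L ≤ y)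
    (hu : y ≤ L * m ^ 2) (σ : ℝ) : y ^ (-σ) ≤ L ^ |σ| * m ^ (-2 * σ) := by
  have hL0 : 0 < L := by linarith
  have hy : 0 < y := lt_of_lt_of_le (by positivity) hl
  have hm2 : m ^ (-2 * σ) = (m ^ 2) ^ (-σ) := by
    rw [← Real.rpow_natCast, ← Real.rpow_mul hm.le]; norm_num
  rw [hm2]
  rcases le_total 0 σ with h | h
  · rw [abs_of_nonneg h]
    calc y ^ (-σ) ≤ (m ^ 2 / L) ^ (-σ) :=
          Real.rpow_le_rpow_of_nonpos (by positivity) hl (by linarith)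
      _ = L ^ σ * (m ^ 2) ^ (-σ) := by
          rw [Real.div_rpow (by positivity) hL0.le, Real.rpow_neg hL0.le, div_inv_eq_mul, mul_comm]
  · rw [abs_of_nonpos h, ← Real.mul_rpow hL0.le (by positivity)]
    exact Real.rpow_le_rpow hy.le hu (by linarith)

theorem hasDerivAt_quadratic_cpow {a b c t : ℝ} (hq : 0 < a + 2 * b * t + c * t ^ 2) (w : ℂ) :
    HasDerivAt (fun u : ℝ => ((a + 2 * b * u + c * u ^ 2 : ℝ) : ℂ) ^ w)
      (w * (2 * (b + c * t)) * ((a + 2 * b * t + c * t ^ 2 : ℝ) : ℂ) ^ (w - 1)) t := by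
  have h1 : HasDerivAt (fun u : ℝ => a + 2 * b * u + c * u ^ 2) (2 * (b + c * t)) t := by
    have := (((hasDerivAt_id t).const_mul (2 * b)).const_add a).add
      (((hasDerivAt_id t).pow 2).const_mul c)
    convert! this using 1
    simp; ring
  have h2 := ((hasDerivAt_id ((a + 2 * b * t + c * t ^ 2 : ℝ) : ℂ)).cpow_const (c := w)
    (Or.inl (by rw [id, Complex.ofReal_re]; exact hq))).scomp t h1.ofReal_comp
  convert! h2 using 1
  simp only [id, smul_eq_mul]
  push_cast
  ring

/-- The quadratic is `Q` along the segment `x + t h`, with `m` of the size of `x` and `L` a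
comparability constant. Every term of the fourth derivative of its power is then of order `m ^ (-2
Re s - 4)`. -/
theorem norm_cpow_quadratic_second_difference_sub_le {a b c m L : ℝ} (s : ℂ) (hm : 0 < m)
    (hL : 1 ≤ L)
    (hl : ∀ t ∈ Set.Icc (-1 : ℝ) 1, m ^ 2 / L ≤ a + 2 * b * t + c * t ^ 2)
    (hu : ∀ t ∈ Set.Icc (-1 : ℝ) 1, a + 2 * b * t + c * t ^ 2 ≤ L * m ^ 2)
    (hb : ∀ t ∈ Set.Icc (-1 : ℝ) 1, |b + c * t| ≤ L * m)
    (hc : |c| ≤ L) :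
    ‖((a + 2 * b + c : ℝ) : ℂ) ^ (-s) + ((a - 2 * b + c : ℝ) : ℂ) ^ (-s) - 2 * (a : ℂ) ^ (-s)
      - (4 * s * (s + 1) * b ^ 2 * (a : ℂ) ^ (-s - 2) - 2 * s * c * (a : ℂ) ^ (-s - 1))‖
      ≤ 2 * (76 * (‖s‖ + 3) ^ 4 * L ^ 8 * L ^ |s.re| * m ^ (-2 * s.re) / m ^ 4) := by
  set q : ℝ → ℝ := fun t => a + 2 * b * t + c * t ^ 2 with hq
  have hL0 : 0 < L := by linarith
  have hqpos : ∀ t ∈ Set.Icc (-1 : ℝ) 1, 0 < q t := fun t ht =>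
    lt_of_lt_of_le (by positivity) (hl t ht)
  have hp : ∀ t ∈ Set.Icc (-1 : ℝ) 1, ∀ w w' : ℂ, w' = w - 1 →
      HasDerivAt (fun u : ℝ => (q u : ℂ) ^ w) (w * (2 * (b + c * t)) * (q t : ℂ) ^ w') t := by
    rintro t ht w _ rfl
    exact hasDerivAt_quadratic_cpow (hqpos t ht) w
  have hlin : ∀ t : ℝ, HasDerivAt (fun u : ℝ => (b : ℂ) + c * u) c t := fun t => by
    simpa using ((Complex.ofRealCLM.hasDerivAt (x := t)).const_mul (c : ℂ)).const_add (b : ℂ)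
  have key := norm_second_difference_sub_le
    (g := fun t => (q t : ℂ) ^ (-s))
    (g1 := fun t => -2 * s * ((b + c * t) * (q t : ℂ) ^ (-s - 1)))
    (g2 := fun t => 4 * s * (s + 1) * ((b + c * t) ^ 2 * (q t : ℂ) ^ (-s - 2))
      - 2 * s * c * (q t : ℂ) ^ (-s - 1))
    (g3 := fun t => 12 * s * (s + 1) * c * ((b + c * t) * (q t : ℂ) ^ (-s - 2))
      - 8 * s * (s + 1) * (s + 2) * ((b + c * t) ^ 3 * (q t : ℂ) ^ (-s - 3)))
    (g4 := fun t => 12 * (s * (s + 1)) * c ^ 2 * (q t : ℂ) ^ (-s - 2)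
      - 48 * (s * (s + 1) * (s + 2)) * (c * (b + c * t) ^ 2) * (q t : ℂ) ^ (-s - 3)
      + 16 * (s * (s + 1) * (s + 2) * (s + 3)) * (b + c * t) ^ 4 * (q t : ℂ) ^ (-s - 4))
    -- `76 = 12 + 48 + 16`, the coefficients of the three terms of `g4`. The powers of `‖s‖ + 3` and
    -- `L` are those of the worst term.
    (M := 76 * (‖s‖ + 3) ^ 4 * L ^ 8 * L ^ |s.re| * m ^ (-2 * s.re) / m ^ 4)
    ?_ ?_ ?_ ?_ ?_
  · convert key using 2
    simp [hq]
    ring_nf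
  · intro t ht
    convert! hp t ht (-s) (-s - 1) (by ring) using 1
    ring
  · intro t ht
    convert! ((hlin t).mul (hp t ht (-s - 1) (-s - 2) (by ring))).const_mul (-2 * s) using 1
    ring
  · intro t ht
    convert! ((((hlin t).pow 2).mul (hp t ht (-s - 2) (-s - 3) (by ring))).const_mul
      (4 * s * (s + 1))).sub ((hp t ht (-s - 1) (-s - 2) (by ring)).const_mul (2 * s * c)) using 1
    simp only [Pi.pow_apply]
    push_cast
    ring
  · intro t ht
    convert! (((hlin t).mul (hp t ht (-s - 2) (-s - 3) (by ring))).const_mul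
      (12 * s * (s + 1) * c)).sub
      ((((hlin t).pow 3).mul (hp t ht (-s - 3) (-s - 4) (by ring))).const_mul
      (8 * s * (s + 1) * (s + 2))) using 1
    simp only [Pi.pow_apply]
    push_cast
    ring
  · intro t ht
    have hq0 := hqpos t ht
    set W : ℝ := L ^ |s.re| * m ^ (-2 * s.re) with hW
    have hW0 : 0 ≤ W := by positivity
    have hP : ∀ k : ℕ, ‖(q t : ℂ) ^ (-s - k)‖ ≤ W * (L ^ k / m ^ (2 * k)) := by
      intro k
      rw [Complex.norm_cpow_eq_rpow_re_of_pos hq0]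
      have : (-s - (k : ℂ)).re = -s.re - k := by simp
      rw [this, Real.rpow_sub hq0, Real.rpow_natCast, div_eq_mul_inv]
      refine mul_le_mul (rpow_neg_le_mul_rpow_neg hm hL (hl t ht) (hu t ht) s.re) ?_
        (by positivity) hW0
      rw [pow_mul, ← div_pow, ← inv_pow]
      refine pow_le_pow_left₀ (by positivity) ?_ k
      rw [← inv_div]
      exact inv_anti₀ (by positivity) (hl t ht)
    have hv : ‖(b : ℂ) + c * t‖ ≤ L * m := by
      have := hb t ht
      rw [← Real.norm_eq_abs, ← Complex.norm_real] at this
      simpa using this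
    have hcn : ‖(c : ℂ)‖ ≤ L := by simpa using hc
    set S := ‖s‖ + 3 with hS
    have hs0 : ‖s‖ ≤ S := by linarith
    have hS1 : 1 ≤ S := by linarith [norm_nonneg s]
    have hs1 : ‖s + 1‖ ≤ S := (norm_add_le _ _).trans (by simp; linarith)
    have hs2 : ‖s + 2‖ ≤ S := (norm_add_le _ _).trans (by simp; linarith)
    have hs3 : ‖s + 3‖ ≤ S := (norm_add_le _ _).trans (by simp; linarith)
    have t1 : ‖12 * (s * (s + 1)) * (c : ℂ) ^ 2 * (q t : ℂ) ^ (-s - 2)‖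
        ≤ 12 * (S ^ 4 * L ^ 8 * W / m ^ 4) := by
      calc _ ≤ 12 * (S * S) * L ^ 2 * (W * (L ^ 2 / m ^ (2 * 2))) := by
            simp only [norm_mul, norm_pow, Complex.norm_ofNat]
            gcongr
            exact_mod_cast hP 2
        _ = 12 * (S ^ 2 * L ^ 4 * W / m ^ 4) := by field_simp
        _ ≤ _ := by gcongr <;> first | assumption | norm_num
    have t2 : ‖48 * (s * (s + 1) * (s + 2)) * (c * (b + c * t) ^ 2) * (q t : ℂ) ^ (-s - 3)‖
        ≤ 48 * (S ^ 4 * L ^ 8 * W / m ^ 4) := by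
      calc _ ≤ 48 * (S * S * S) * (L * (L * m) ^ 2) * (W * (L ^ 3 / m ^ (2 * 3))) := by
            simp only [norm_mul, norm_pow, Complex.norm_ofNat]
            gcongr
            exact_mod_cast hP 3
        _ = 48 * (S ^ 3 * L ^ 6 * W / m ^ 4) := by field_simp; ring
        _ ≤ _ := by gcongr <;> first | assumption | norm_num
    have t3 : ‖16 * (s * (s + 1) * (s + 2) * (s + 3)) * ((b : ℂ) + c * t) ^ 4
        * (q t : ℂ) ^ (-s - 4)‖ ≤ 16 * (S ^ 4 * L ^ 8 * W / m ^ 4) := by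
      calc _ ≤ 16 * (S * S * S * S) * (L * m) ^ 4 * (W * (L ^ 4 / m ^ (2 * 4))) := by
            simp only [norm_mul, norm_pow, Complex.norm_ofNat]
            gcongr
            exact_mod_cast hP 4
        _ = _ := by field_simp; ring
    calc _ ≤ 12 * (S ^ 4 * L ^ 8 * W / m ^ 4) + 48 * (S ^ 4 * L ^ 8 * W / m ^ 4)
          + 16 * (S ^ 4 * L ^ 8 * W / m ^ 4) :=
          (norm_add_le _ _).trans (add_le_add ((norm_sub_le _ _).trans (add_le_add t1 t2)) t3)
      _ = _ := by rw [hW]; ring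

/-! ### Cubes as sup-norm balls, and the quadratic form against the sup norm. -/

theorem mem_cube_iff {N : ℕ} {x : Fin d → ℝ} : x ∈ cube d N ↔ ‖x‖ ≤ (N : ℝ) + 1 / 2 := by
  rw [pi_norm_le_iff_of_nonneg (by positivity), cube, Set.mem_Icc, Pi.le_def, Pi.le_def,
    ← forall_and]
  refine forall_congr' fun i => ?_
  rw [Real.norm_eq_abs, abs_le, neg_add']

theorem isCompact_cube (N : ℕ) : IsCompact (cube d N) := isCompact_Icc

theorem integrableOn_cube_of_continuous {E : Type*} [NormedAddCommGroup E] {N : ℕ}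
    {f : (Fin d → ℝ) → E} (hf : Continuous f) : IntegrableOn f (cube d N) :=
  hf.integrableOn_Icc

theorem neg_mem_cube {N : ℕ} {x : Fin d → ℝ} (hx : x ∈ cube d N) : -x ∈ cube d N := by
  rwa [mem_cube_iff, norm_neg, ← mem_cube_iff]

theorem continuous_cubicForm : Continuous (cubicForm d) := by
  unfold cubicForm
  fun_prop

theorem cubicForm_smul (c : ℝ) (x : Fin d → ℝ) : cubicForm d (c • x) = c ^ 2 * cubicForm d x := by
  simp [cubicForm, Finset.mul_sum, mul_pow]

theorem cubicForm_nonneg (x : Fin d → ℝ) : 0 ≤ cubicForm d x :=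
  Finset.sum_nonneg fun i _ => sq_nonneg (x i)

theorem norm_sq_le_cubicForm (x : Fin d → ℝ) : ‖x‖ ^ 2 ≤ cubicForm d x := by
  refine (Real.le_sqrt (norm_nonneg _) (cubicForm_nonneg x)).mp ?_
  refine (pi_norm_le_iff_of_nonneg (Real.sqrt_nonneg _)).mpr fun i => ?_
  refine (Real.le_sqrt (norm_nonneg _) (cubicForm_nonneg x)).mpr ?_
  rw [Real.norm_eq_abs, sq_abs]
  exact Finset.single_le_sum (f := fun i => x i ^ 2) (fun i _ => sq_nonneg (x i))
    (Finset.mem_univ i)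

theorem cubicForm_le (x : Fin d → ℝ) : cubicForm d x ≤ d * ‖x‖ ^ 2 := by
  calc cubicForm d x ≤ ∑ _i : Fin d, ‖x‖ ^ 2 := by
        refine Finset.sum_le_sum fun i _ => ?_
        rw [← sq_abs, ← Real.norm_eq_abs]
        gcongr
        exact norm_le_pi_norm x i
    _ = _ := by simp

theorem cubicForm_pos {x : Fin d → ℝ} (hx : x ≠ 0) : 0 < cubicForm d x :=
  lt_of_lt_of_le (by have := norm_pos_iff.mpr hx; positivity) (norm_sq_le_cubicForm x)

theorem cubicForm_add_smul (x h : Fin d → ℝ) (t : ℝ) :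
    cubicForm d (x + t • h) = cubicForm d x + 2 * (x ⬝ᵥ h) * t + cubicForm d h * t ^ 2 := by
  simp only [cubicForm, dotProduct, Finset.mul_sum, Finset.sum_mul, ← Finset.sum_add_distrib]
  refine Finset.sum_congr rfl fun i _ => ?_
  simp
  ring

theorem abs_dotProduct_le (x y : Fin d → ℝ) : |x ⬝ᵥ y| ≤ d * (‖x‖ * ‖y‖) := by
  calc |x ⬝ᵥ y| ≤ ∑ i, |x i * y i| := Finset.abs_sum_le_sum_abs _ _
    _ ≤ ∑ _i : Fin d, ‖x‖ * ‖y‖ := by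
        refine Finset.sum_le_sum fun i _ => ?_
        rw [abs_mul]
        gcongr
        · exact norm_le_pi_norm x i
        · exact norm_le_pi_norm y i
    _ = _ := by simp

theorem norm_symmetrized_cubicForm_cpow_sub_le (hd : 1 ≤ d) (s : ℂ) {x h : Fin d → ℝ}
    (hx : 1 ≤ ‖x‖) (hh : ‖h‖ ≤ 1 / 2) :
    ‖(cubicForm d (x + h) : ℂ) ^ (-s) + (cubicForm d (x - h) : ℂ) ^ (-s)
      - 2 * (cubicForm d x : ℂ) ^ (-s)
      - (4 * s * (s + 1) * (x ⬝ᵥ h : ℝ) ^ 2 * (cubicForm d x : ℂ) ^ (-s - 2)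
        - 2 * s * cubicForm d h * (cubicForm d x : ℂ) ^ (-s - 1))‖
      ≤ 2 * (76 * (‖s‖ + 3) ^ 4 * (9 * d) ^ 8 * (9 * d : ℝ) ^ |s.re| * ‖x‖ ^ (-2 * s.re)
        / ‖x‖ ^ 4) := by
  have hd' : (1 : ℝ) ≤ d := by exact_mod_cast hd
  have hth : ∀ t ∈ Set.Icc (-1 : ℝ) 1, ‖t • h‖ ≤ 1 / 2 := fun t ht => by
    rw [norm_smul, Real.norm_eq_abs]
    have := abs_le.mpr ht
    nlinarith [abs_nonneg t, norm_nonneg h]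
  have hup : ∀ t ∈ Set.Icc (-1 : ℝ) 1, ‖x + t • h‖ ≤ 3 / 2 * ‖x‖ := fun t ht =>
    (norm_add_le _ _).trans (by linarith [hth t ht])
  have hlo : ∀ t ∈ Set.Icc (-1 : ℝ) 1, ‖x‖ / 2 ≤ ‖x + t • h‖ := fun t ht => by
    have h1 := norm_sub_le (x + t • h) (t • h)
    rw [add_sub_cancel_right] at h1
    linarith [hth t ht]
  -- Since `‖h‖ ≤ 1/2 ≤ ‖x‖ / 2`, the segment stays between `‖x‖ / 2` and `3/2 * ‖x‖` in norm. With
  -- `‖y‖² ≤ Q(y) ≤ d ‖y‖²`, the generous choice `L = 9 * d` meets all four conditions.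
  have key := norm_cpow_quadratic_second_difference_sub_le (a := cubicForm d x) (b := x ⬝ᵥ h)
    (c := cubicForm d h) (m := ‖x‖) (L := 9 * d) s (by linarith) (by linarith)
    (fun t ht => by
      rw [← cubicForm_add_smul]
      refine le_trans ?_ (norm_sq_le_cubicForm _)
      rw [div_le_iff₀ (by positivity)]
      have h1 : (‖x‖ / 2) ^ 2 ≤ ‖x + t • h‖ ^ 2 := by gcongr; exact hlo t ht
      nlinarith [sq_nonneg ‖x‖, sq_nonneg ‖x + t • h‖])
    (fun t ht => by
      rw [← cubicForm_add_smul]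
      refine (cubicForm_le _).trans ?_
      have h1 : ‖x + t • h‖ ^ 2 ≤ (3 / 2 * ‖x‖) ^ 2 := by gcongr; exact hup t ht
      nlinarith [sq_nonneg ‖x‖, sq_nonneg ‖x + t • h‖])
    (fun t ht => by
      have h1 : x ⬝ᵥ h + cubicForm d h * t = (x + t • h) ⬝ᵥ h := by
        simp only [cubicForm, dotProduct, Finset.sum_mul, ← Finset.sum_add_distrib]
        refine Finset.sum_congr rfl fun i _ => ?_
        simp
        ring
      rw [h1]
      refine (abs_dotProduct_le _ _).trans ?_
      calc (d : ℝ) * (‖x + t • h‖ * ‖h‖) ≤ d * (3 / 2 * ‖x‖ * (1 / 2)) := by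
            gcongr; exact hup t ht
        _ ≤ _ := by nlinarith)
    (by
      rw [abs_of_nonneg (cubicForm_nonneg h)]
      refine (cubicForm_le h).trans ?_
      have : ‖h‖ ^ 2 ≤ (1 / 2) ^ 2 := by gcongr
      nlinarith)
  have e1 : cubicForm d (x + h) = cubicForm d x + 2 * (x ⬝ᵥ h) + cubicForm d h := by
    simpa using cubicForm_add_smul x h 1
  have e2 : cubicForm d (x - h) = cubicForm d x - 2 * (x ⬝ᵥ h) + cubicForm d h := by
    simpa [sub_eq_add_neg] using cubicForm_add_smul x h (-1)
  rw [e1, e2]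
  exact key

/-! ### Second moments of the unit cube. -/

theorem restrict_cube_zero_eq_pi :
    (volume : Measure (Fin d → ℝ)).restrict (cube d 0)
      = Measure.pi fun _ => volume.restrict (Set.Icc (-(1 / 2) : ℝ) (1 / 2)) := by
  rw [← Measure.restrict_pi_pi, volume_pi, cube, ← Set.pi_univ_Icc]
  simp

theorem volume_real_cube_zero : (volume : Measure (Fin d → ℝ)).real (cube d 0) = 1 := by
  rw [measureReal_def, cube, Real.volume_Icc_pi]
  norm_num

theorem integral_mul_coord_cube_zero (i j : Fin d) :
    ∫ h in cube d 0, h i * h j = if i = j then 1 / 12 else 0 := by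
  have h1 : ∫ u in Set.Icc (-(1 / 2) : ℝ) (1 / 2), u = 0 := by
    rw [integral_Icc_eq_integral_Ioc, ← intervalIntegral.integral_of_le (by norm_num), integral_id]
    norm_num
  have h2 : ∫ u in Set.Icc (-(1 / 2) : ℝ) (1 / 2), u * u = 1 / 12 := by
    simp_rw [← sq]
    rw [integral_Icc_eq_integral_Ioc, ← intervalIntegral.integral_of_le (by norm_num), integral_pow]
    norm_num
  have h0 : ∫ _u in Set.Icc (-(1 / 2) : ℝ) (1 / 2), (1 : ℝ) = 1 := by
    simp
    norm_num
  -- Writing the monomial as a product over all coordinates lets Fubini factor the integral, with `i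
  -- = j` and `i ≠ j` treated by the same formula.
  have hprod : ∀ h : Fin d → ℝ, h i * h j
      = ∏ k, ((if k = i then h k else 1) * (if k = j then h k else 1)) := fun h => by
    rw [Finset.prod_mul_distrib]
    simp
  simp_rw [hprod]
  rw [restrict_cube_zero_eq_pi, integral_fintype_prod_eq_prod
    (f := fun k u => (if k = i then u else 1) * (if k = j then u else 1))]
  split_ifs with hij
  · subst hij
    rw [Finset.prod_eq_single i]
    · simpa using h2
    · intro k _ hk
      simpa [hk] using h0
    · simp
  · refine Finset.prod_eq_zero (Finset.mem_univ i) ?_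
    simpa [hij] using h1

theorem integral_cubicForm_cube_zero : ∫ h in cube d 0, cubicForm d h = d / 12 := by
  simp only [cubicForm, sq]
  rw [integral_finsetSum]
  · simp [integral_mul_coord_cube_zero, div_eq_mul_inv]
  · intro i _
    exact integrableOn_cube_of_continuous (by fun_prop)

theorem integral_dotProduct_sq_cube_zero (x : Fin d → ℝ) :
    ∫ h in cube d 0, (x ⬝ᵥ h) ^ 2 = cubicForm d x / 12 := by
  have : ∀ h : Fin d → ℝ, (x ⬝ᵥ h) ^ 2 = ∑ i, ∑ j, x i * x j * (h i * h j) := fun h => by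
    rw [sq, dotProduct, Finset.sum_mul_sum]
    exact Finset.sum_congr rfl fun i _ => Finset.sum_congr rfl fun j _ => by ring
  simp_rw [this]
  rw [integral_finsetSum _ fun i _ => integrableOn_cube_of_continuous (by fun_prop)]
  have hi : ∀ i, ∫ h in cube d 0, ∑ j, x i * x j * (h i * h j)
      = ∑ j, x i * x j * if i = j then 1 / 12 else 0 := fun i => by
    rw [integral_finsetSum _ fun j _ => integrableOn_cube_of_continuous (by fun_prop)]
    simp_rw [integral_const_mul, integral_mul_coord_cube_zero]
  simp_rw [hi]
  simp [cubicForm, Finset.sum_mul, sq, div_eq_mul_inv]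

/-! ### The midpoint rule on a unit cell. -/

/-- The error of the midpoint rule for `Q ^ (-s)` on the unit cube centred at `x`. -/
noncomputable def cellError (s : ℂ) (x : Fin d → ℝ) : ℂ :=
  (cubicForm d x : ℂ) ^ (-s) - ∫ h in cube d 0, (cubicForm d (x + h) : ℂ) ^ (-s)

/-- The midpoint rule error, corrected by the term of second order. -/
noncomputable def cellRemainder (s : ℂ) (x : Fin d → ℝ) : ℂ :=
  cellError s x + 1 / 6 * s * (s + 1 - d / 2) * (cubicForm d x : ℂ) ^ (-(s + 1))

theorem add_ne_zero_of_mem_cube_zero {x h : Fin d → ℝ} (hx : 1 ≤ ‖x‖) (hh : h ∈ cube d 0) :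
    x + h ≠ 0 := by
  rw [mem_cube_iff] at hh
  intro h0
  rw [eq_neg_of_add_eq_zero_left h0, norm_neg] at hx
  norm_num at hh
  linarith

theorem integrableOn_cubicForm_add_cpow (s : ℂ) {x : Fin d → ℝ} (hx : 1 ≤ ‖x‖) :
    IntegrableOn (fun h => (cubicForm d (x + h) : ℂ) ^ (-s)) (cube d 0) := by
  refine ContinuousOn.integrableOn_compact (isCompact_cube 0) ?_
  refine ContinuousOn.cpow_const ?_ fun h hh => Or.inl ?_
  · exact (Complex.continuous_ofReal.comp
      (continuous_cubicForm.comp (continuous_const.add continuous_id))).continuousOn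
  · exact cubicForm_pos (add_ne_zero_of_mem_cube_zero hx hh)

/-- The cell is invariant under `h ↦ -h`, so the symmetrized second difference integrates to twice
the negated midpoint error. The second moments turn its quadratic part into `(1/3) s (s + 1 - d/2)
Q(x)^(-s-1)`, so what is left is `-2 * cellRemainder`, controlled pointwise by the fourth-order
estimate. -/
theorem norm_cellRemainder_le (hd : 1 ≤ d) (s : ℂ) {x : Fin d → ℝ} (hx : 1 ≤ ‖x‖) :
    ‖cellRemainder s x‖ ≤ 76 * (‖s‖ + 3) ^ 4 * (9 * d) ^ 8 * (9 * d : ℝ) ^ |s.re|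
      * ‖x‖ ^ (-2 * s.re) / ‖x‖ ^ 4 := by
  set K := 76 * (‖s‖ + 3) ^ 4 * (9 * d) ^ 8 * (9 * d : ℝ) ^ |s.re|
      * ‖x‖ ^ (-2 * s.re) / ‖x‖ ^ 4 with hK
  have hx0 : x ≠ 0 := norm_pos_iff.mp (by linarith)
  have hQ : (cubicForm d x : ℂ) ≠ 0 := by exact_mod_cast (cubicForm_pos hx0).ne'
  have i1 := integrableOn_cubicForm_add_cpow s hx
  have hneg : MeasurePreserving (fun h : Fin d → ℝ => -h) (volume.restrict (cube d 0))
      (volume.restrict (cube d 0)) := by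
    have := (Measure.measurePreserving_neg (volume : Measure (Fin d → ℝ))).restrict_preimage_emb
      (MeasurableEquiv.neg (Fin d → ℝ)).measurableEmbedding (cube d 0)
    have he : (Neg.neg : (Fin d → ℝ) → _) ⁻¹' cube d 0 = cube d 0 := by
      ext h
      exact ⟨fun hh => by simpa using neg_mem_cube hh, neg_mem_cube⟩
    rwa [he] at this
  have i2 : IntegrableOn (fun h => (cubicForm d (x - h) : ℂ) ^ (-s)) (cube d 0) := by
    simpa [IntegrableOn, Function.comp_def, sub_eq_add_neg] using
      (hneg.integrable_comp_emb (MeasurableEquiv.neg (Fin d → ℝ)).measurableEmbedding).mpr i1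
  have e2 : ∫ h in cube d 0, (cubicForm d (x - h) : ℂ) ^ (-s)
      = ∫ h in cube d 0, (cubicForm d (x + h) : ℂ) ^ (-s) := by
    simpa [sub_eq_add_neg] using
      hneg.integral_comp (MeasurableEquiv.neg (Fin d → ℝ)).measurableEmbedding
        (fun h => (cubicForm d (x + h) : ℂ) ^ (-s))
  have i4 : IntegrableOn (fun h : Fin d → ℝ => (((x ⬝ᵥ h) ^ 2 : ℝ) : ℂ)) (cube d 0) := by
    refine integrableOn_cube_of_continuous ?_
    unfold dotProduct
    fun_prop
  have i5 : IntegrableOn (fun h : Fin d → ℝ => (cubicForm d h : ℂ)) (cube d 0) :=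
    integrableOn_cube_of_continuous (Complex.continuous_ofReal.comp continuous_cubicForm)
  have i3 : IntegrableOn (fun _ : Fin d → ℝ => 2 * (cubicForm d x : ℂ) ^ (-s)) (cube d 0) :=
    integrableOn_cube_of_continuous continuous_const
  have e4 : ∫ h in cube d 0, (((x ⬝ᵥ h) ^ 2 : ℝ) : ℂ) = cubicForm d x / 12 := by
    rw [integral_complex_ofReal, integral_dotProduct_sq_cube_zero]
    simp
  have e5 : ∫ h in cube d 0, (cubicForm d h : ℂ) = d / 12 := by
    rw [integral_complex_ofReal, integral_cubicForm_cube_zero]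
    simp
  have hint : ∫ h in cube d 0, ((cubicForm d (x + h) : ℂ) ^ (-s) + (cubicForm d (x - h) : ℂ) ^ (-s)
      - 2 * (cubicForm d x : ℂ) ^ (-s)
      - (4 * s * (s + 1) * (cubicForm d x : ℂ) ^ (-s - 2) * (((x ⬝ᵥ h) ^ 2 : ℝ) : ℂ)
        - 2 * s * (cubicForm d x : ℂ) ^ (-s - 1) * cubicForm d h)) = -2 * cellRemainder s x := by
    have i4' := i4.const_mul (4 * s * (s + 1) * (cubicForm d x : ℂ) ^ (-s - 2))
    have i5' := i5.const_mul (2 * s * (cubicForm d x : ℂ) ^ (-s - 1))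
    have i12 : IntegrableOn (fun h => (cubicForm d (x + h) : ℂ) ^ (-s)
      + (cubicForm d (x - h) : ℂ) ^ (-s)) (cube d 0) := i1.add i2
    have i123 : IntegrableOn (fun h => (cubicForm d (x + h) : ℂ) ^ (-s)
      + (cubicForm d (x - h) : ℂ) ^ (-s) - 2 * (cubicForm d x : ℂ) ^ (-s)) (cube d 0) :=
      i12.sub i3
    rw [integral_sub i123 (by exact i4'.sub i5'),
      integral_sub i12 i3, integral_add i1 i2, e2, integral_sub i4' i5', integral_const_mul,
      integral_const_mul, integral_const_mul, e4,
      e5, setIntegral_const, volume_real_cube_zero, one_smul, cellRemainder, cellError]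
    have p2 : (cubicForm d x : ℂ) ^ (-s - 2)
        = (cubicForm d x : ℂ) ^ (-s - 1) / cubicForm d x := by
      rw [show -s - 2 = (-s - 1) - 1 by ring, Complex.cpow_sub _ _ hQ, Complex.cpow_one]
    rw [p2, neg_add']
    field_simp
    ring
  have hle : ‖-2 * cellRemainder s x‖ ≤ 2 * K := by
    rw [← hint]
    refine (norm_setIntegral_le_of_norm_le_const (C := 2 * K)
      (isCompact_cube 0).measure_lt_top fun h hh => ?_).trans ?_
    · have hh' : ‖h‖ ≤ 1 / 2 := by simpa using mem_cube_iff.mp hh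
      refine le_trans (le_of_eq ?_) (norm_symmetrized_cubicForm_cpow_sub_le hd s hx hh')
      congr 1
      push_cast
      ring
    · rw [volume_real_cube_zero, mul_one]
  rw [norm_mul, norm_neg, Complex.norm_ofNat] at hle
  linarith

/-! ### Lattice sums of the cell remainders and holomorphy in `s`. -/

/-- The inclusion of `ℤ^d` into `ℝ^d`. -/
def intVec (n : Fin d → ℤ) : Fin d → ℝ := fun i => (n i : ℝ)

theorem intVec_injective : Function.Injective (intVec (d := d)) := fun _ _ h =>
  funext fun i => Int.cast_injective (congrFun h i)

theorem one_le_norm_intVec {n : Fin d → ℤ} (hn : n ≠ 0) : 1 ≤ ‖intVec n‖ := by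
  obtain ⟨i, hi⟩ := Function.ne_iff.mp hn
  refine le_trans ?_ (norm_le_pi_norm (intVec n) i)
  rw [intVec, Real.norm_eq_abs, ← Int.cast_abs]
  exact_mod_cast Int.one_le_abs hi

theorem intVec_ne_zero {n : Fin d → ℤ} (hn : n ≠ 0) : intVec n ≠ 0 :=
  norm_pos_iff.mp (by linarith [one_le_norm_intVec hn])

theorem summable_norm_intVec_rpow {r : ℝ} (hr : r < -d) :
    Summable fun n : Fin d → ℤ => ‖intVec n‖ ^ r := by
  let L := Submodule.span ℤ (Set.range (Pi.basisFun ℝ (Fin d)))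
  have hL : ∀ n : Fin d → ℤ, intVec n ∈ L := fun n =>
    ((Pi.basisFun ℝ (Fin d)).mem_span_iff_repr_mem ℤ _).mpr fun i => ⟨n i, by simp [intVec]⟩
  have hrank : Module.finrank ℤ L = d := by simp [ZLattice.rank ℝ L]
  have h := ZLattice.summable_norm_rpow L r (by rw [hrank]; exact hr)
  exact h.comp_injective (i := fun n => (⟨intVec n, hL n⟩ : L)) fun m n hmn =>
    intVec_injective (congrArg Subtype.val hmn)

theorem summable_cubicForm_intVec_rpow {σ : ℝ} (hσ : (d : ℝ) / 2 < σ) :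
    Summable fun n : {n : Fin d → ℤ // n ≠ 0} => cubicForm d (intVec n.1) ^ (-σ) := by
  have h := (summable_norm_intVec_rpow (d := d) (r := -2 * σ) (by linarith)).comp_injective
    (Subtype.val_injective (p := fun n : Fin d → ℤ => n ≠ 0))
  refine Summable.of_nonneg_of_le
    (fun n => Real.rpow_nonneg (cubicForm_nonneg _) _) (fun n => ?_) h
  have h1 := one_le_norm_intVec n.2
  have h2 : (0 : ℝ) ≤ d := by positivity
  calc cubicForm d (intVec n.1) ^ (-σ) ≤ (‖intVec n.1‖ ^ 2) ^ (-σ) :=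
        Real.rpow_le_rpow_of_nonpos (by positivity) (norm_sq_le_cubicForm _) (by linarith)
    _ = _ := by
        rw [← Real.rpow_natCast, ← Real.rpow_mul (by positivity)]
        norm_num

open ProbabilityTheory in
-- The integral is the complex moment generating function of `-log φ`. This variable is bounded and
-- the measure finite, so the function is entire.
theorem differentiable_integral_cpow_neg {X : Type*} [MeasurableSpace X] {μ : Measure X}
    [IsFiniteMeasure μ] {φ : X → ℝ} (hφ : AEMeasurable φ μ) {a b : ℝ} (ha : 0 < a)
    (hab : ∀ᵐ x ∂μ, a ≤ φ x ∧ φ x ≤ b) :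
    Differentiable ℂ fun s : ℂ => ∫ x, (φ x : ℂ) ^ (-s) ∂μ := by
  have hlog : AEMeasurable (fun x => -Real.log (φ x)) μ := hφ.log.neg
  have hset : integrableExpSet (fun x => -Real.log (φ x)) μ = Set.univ := by
    refine Set.eq_univ_of_forall fun t => ?_
    have hbd : ∀ᵐ x ∂μ, -Real.log (φ x) ∈ Set.Icc (-Real.log b) (-Real.log a) := by
      filter_upwards [hab] with x hx
      exact ⟨neg_le_neg (Real.log_le_log (ha.trans_le hx.1) hx.2),
        neg_le_neg (Real.log_le_log ha hx.1)⟩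
    exact integrable_exp_mul_of_mem_Icc hlog hbd
  have heq : (fun s : ℂ => ∫ x, (φ x : ℂ) ^ (-s) ∂μ)
      = complexMGF (fun x => -Real.log (φ x)) μ := by
    funext s
    refine integral_congr_ae ?_
    filter_upwards [hab] with x hx
    have hx0 : 0 < φ x := ha.trans_le hx.1
    rw [Complex.cpow_def_of_ne_zero (by exact_mod_cast hx0.ne'), ← Complex.ofReal_log hx0.le]
    push_cast
    ring_nf
  rw [heq]
  exact fun s => (hasDerivAt_complexMGF (by rw [hset]; simp)).differentiableAt

theorem differentiable_cubicForm_cpow_neg {x : Fin d → ℝ} (hx : x ≠ 0) :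
    Differentiable ℂ fun s : ℂ => (cubicForm d x : ℂ) ^ (-s) :=
  differentiable_neg.const_cpow (Or.inl (by exact_mod_cast (cubicForm_pos hx).ne'))

theorem differentiable_cellError {x : Fin d → ℝ} (hx : 1 ≤ ‖x‖) :
    Differentiable ℂ fun s : ℂ => cellError s x := by
  have hx0 : x ≠ 0 := norm_pos_iff.mp (by linarith)
  refine (differentiable_cubicForm_cpow_neg hx0).sub ?_
  have hc : Continuous fun h : Fin d → ℝ => cubicForm d (x + h) :=
    continuous_cubicForm.comp (continuous_const.add continuous_id)
  have : IsFiniteMeasure ((volume : Measure (Fin d → ℝ)).restrict (cube d 0)) :=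
    ⟨by simpa using (isCompact_cube 0).measure_lt_top⟩
  refine differentiable_integral_cpow_neg (a := (1 / 2) ^ 2) (b := d * (‖x‖ + 1 / 2) ^ 2)
    hc.aemeasurable (by norm_num) ?_
  refine (ae_restrict_mem (isCompact_cube 0).measurableSet).mono fun h hh => ?_
  have hh' : ‖h‖ ≤ 1 / 2 := by simpa using mem_cube_iff.mp hh
  constructor
  · refine le_trans ?_ (norm_sq_le_cubicForm _)
    have h1 := norm_sub_le (x + h) h
    rw [add_sub_cancel_right] at h1
    gcongr
    linarith
  · refine (cubicForm_le _).trans ?_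
    gcongr
    exact (norm_add_le _ _).trans (by linarith)

theorem differentiable_cellRemainder {x : Fin d → ℝ} (hx : 1 ≤ ‖x‖) :
    Differentiable ℂ fun s : ℂ => cellRemainder s x := by
  have hx0 : x ≠ 0 := norm_pos_iff.mp (by linarith)
  have h1 : Differentiable ℂ fun s : ℂ => (cubicForm d x : ℂ) ^ (-(s + 1)) :=
    (differentiable_cubicForm_cpow_neg hx0).comp (differentiable_id.add_const 1)
  exact (differentiable_cellError hx).add (Differentiable.mul (by fun_prop) h1)

/-- The majorant depends on `s` only through `A` and `τ`, as the Weierstrass test requires. It is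
summable over the lattice when `-2 τ - 4 < -d`, that is `τ > d/2 - 2`. -/
theorem norm_cellRemainder_intVec_le (hd : 1 ≤ d) {s : ℂ} {A τ : ℝ} (hA : ‖s‖ ≤ A)
    (hτ : τ ≤ s.re) {n : Fin d → ℤ} (hn : n ≠ 0) :
    ‖cellRemainder s (intVec n)‖ ≤ 76 * (A + 3) ^ 4 * (9 * d) ^ 8 * (9 * d : ℝ) ^ A
      * ‖intVec n‖ ^ (-2 * τ - 4) := by
  have hd' : (1 : ℝ) ≤ d := by exact_mod_cast hd
  have h1 := one_le_norm_intVec hn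
  have hA0 : 0 ≤ A := (norm_nonneg s).trans hA
  refine (norm_cellRemainder_le hd s h1).trans ?_
  have h4 : ‖intVec n‖ ^ (-2 * s.re) / ‖intVec n‖ ^ 4 = ‖intVec n‖ ^ (-2 * s.re - 4) := by
    rw [Real.rpow_sub (by linarith)]
    norm_cast
  rw [mul_div_assoc, h4]
  gcongr ?_ * ?_
  · gcongr
    · linarith
    · exact (Complex.abs_re_le_norm s).trans hA
  · exact Real.rpow_le_rpow_of_exponent_le h1 (by linarith)

theorem summable_cellRemainder_bound {τ : ℝ} (hτ : (d : ℝ) / 2 - 2 < τ) (K : ℝ) :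
    Summable fun n : {n : Fin d → ℤ // n ≠ 0} => K * ‖intVec n.1‖ ^ (-2 * τ - 4) :=
  ((summable_norm_intVec_rpow (d := d) (r := -2 * τ - 4) (by linarith)).comp_injective
    Subtype.val_injective).mul_left K

theorem summable_cellRemainder (hd : 1 ≤ d) {s : ℂ} (hs : (d : ℝ) / 2 - 2 < s.re) :
    Summable fun n : {n : Fin d → ℤ // n ≠ 0} => cellRemainder s (intVec n.1) :=
  Summable.of_norm_bounded (summable_cellRemainder_bound hs _)
    fun n => norm_cellRemainder_intVec_le hd le_rfl le_rfl n.2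

/-- The sum of the corrected midpoint rule errors over all nonzero lattice points. -/
noncomputable def remainderSum (d : ℕ) (s : ℂ) : ℂ :=
  ∑' n : {n : Fin d → ℤ // n ≠ 0}, cellRemainder s (intVec n.1)

theorem differentiableAt_remainderSum (hd : 1 ≤ d) {s : ℂ} (hs : (d : ℝ) / 2 - 2 < s.re) :
    DifferentiableAt ℂ (remainderSum d) s := by
  obtain ⟨τ, hτ, hτs⟩ := exists_between hs
  have hU : IsOpen ({w : ℂ | τ < w.re} ∩ Metric.ball 0 (‖s‖ + 1)) :=
    (isOpen_lt continuous_const Complex.continuous_re).inter Metric.isOpen_ball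
  refine DifferentiableOn.differentiableAt (Complex.differentiableOn_tsum_of_summable_norm
    (summable_cellRemainder_bound hτ
      (76 * (‖s‖ + 1 + 3) ^ 4 * (9 * d) ^ 8 * (9 * d : ℝ) ^ (‖s‖ + 1)))
    (fun n => (differentiable_cellRemainder (one_le_norm_intVec n.2)).differentiableOn) hU
    fun n w hw => ?_) (hU.mem_nhds ⟨hτs, by simp⟩)
  exact norm_cellRemainder_intVec_le hd (mem_ball_zero_iff.mp hw.2).le hw.1.le n.2

/-! ### Polar coordinates for the sup norm. -/

/-- The integral of `Q ^ (-s)` over the unit sphere of the sup norm, with respect to the surface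
measure of polar coordinates. -/
noncomputable def sphereIntegral (d : ℕ) (s : ℂ) : ℂ :=
  ∫ ω : Metric.sphere (0 : Fin d → ℝ) 1, (cubicForm d ω : ℂ) ^ (-s)
    ∂(volume : Measure (Fin d → ℝ)).toSphere

theorem one_le_cubicForm_sphere (ω : Metric.sphere (0 : Fin d → ℝ) 1) : 1 ≤ cubicForm d ω := by
  simpa using norm_sq_le_cubicForm (ω : Fin d → ℝ)

theorem differentiable_sphereIntegral (d : ℕ) : Differentiable ℂ (sphereIntegral d) := by
  refine differentiable_integral_cpow_neg (a := 1) (b := d)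
    (continuous_cubicForm.comp continuous_subtype_val).aemeasurable one_pos
    (ae_of_all _ fun ω => ⟨one_le_cubicForm_sphere ω, ?_⟩)
  simpa using cubicForm_le (ω : Fin d → ℝ)

theorem integrable_sphere_cubicForm_cpow (s : ℂ) :
    Integrable (fun ω : Metric.sphere (0 : Fin d → ℝ) 1 => (cubicForm d ω : ℂ) ^ (-s))
      (volume : Measure (Fin d → ℝ)).toSphere := by
  refine Continuous.integrable_of_hasCompactSupport ?_ (HasCompactSupport.of_compactSpace _)
  refine Continuous.cpow ?_ continuous_const fun ω => Or.inl ?_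
  · exact Complex.continuous_ofReal.comp (continuous_cubicForm.comp continuous_subtype_val)
  · exact_mod_cast one_pos.trans_le (one_le_cubicForm_sphere ω)

theorem integrable_volumeIoiPow_iff {n : ℕ} {g : ℝ → ℂ} :
    Integrable (fun r : Set.Ioi (0 : ℝ) => g r) (Measure.volumeIoiPow n)
      ↔ IntegrableOn (fun r : ℝ => (r : ℂ) ^ n * g r) (Set.Ioi 0) := by
  rw [Measure.volumeIoiPow, integrable_withDensity_iff_integrable_smul',
    integrableOn_iff_comap_subtypeVal measurableSet_Ioi]
  · refine integrable_congr (ae_of_all _ fun r => ?_)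
    have : (0 : ℝ) ≤ (r : ℝ) ^ n := pow_nonneg (le_of_lt r.2) n
    simp [ENNReal.toReal_ofReal this]
  · fun_prop
  · simp

theorem integral_volumeIoiPow {n : ℕ} {g : ℝ → ℂ} :
    ∫ r : Set.Ioi (0 : ℝ), g r ∂(Measure.volumeIoiPow n)
      = ∫ r in Set.Ioi (0 : ℝ), (r : ℂ) ^ n * g r := by
  simp only [Measure.volumeIoiPow, ENNReal.ofReal]
  rw [integral_withDensity_eq_integral_smul,
    integral_subtype_comap measurableSet_Ioi fun a : ℝ => Real.toNNReal (a ^ n) • g a,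
    setIntegral_congr_fun measurableSet_Ioi fun x hx => ?_]
  · rw [NNReal.smul_def, Real.coe_toNNReal _ (pow_nonneg hx.out.le _)]
    simp
  · exact (measurable_subtype_coe.pow_const _).real_toNNReal

theorem cubicForm_cpow_eq_polar (s : ℂ) {x : Fin d → ℝ} (hx : x ≠ 0) :
    (cubicForm d x : ℂ) ^ (-s)
      = (cubicForm d (‖x‖⁻¹ • x) : ℂ) ^ (-s) * (‖x‖ : ℂ) ^ (-2 * s) := by
  have h0 : 0 < ‖x‖ := norm_pos_iff.mpr hx
  have h1 : cubicForm d x = cubicForm d (‖x‖⁻¹ • x) * ‖x‖ ^ 2 := by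
    rw [cubicForm_smul]
    field_simp
  conv_lhs => rw [h1]
  rw [Complex.ofReal_mul, Complex.mul_cpow_ofReal_nonneg (cubicForm_nonneg _) (by positivity)]
  congr 1
  rw [Complex.ofReal_pow, ← Complex.cpow_nat_mul']
  · push_cast
    ring_nf
  · simp [Complex.arg_ofReal_of_nonneg h0.le, Real.pi_pos]
  · simp [Complex.arg_ofReal_of_nonneg h0.le, Real.pi_pos.le]

/-- Spheres of the sup norm are boundaries of cubes, so in these coordinates integrals over cubes
and cubical shells become one-dimensional. The exponent combines the radial density `r ^ (d - 1)`
with the homogeneity factor `r ^ (-2 s)`. -/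
theorem integral_cubicForm_cpow_polar (hd : 1 ≤ d) (s : ℂ) {I : Set ℝ} (hI : MeasurableSet I)
    (hI0 : I ⊆ Set.Ioi 0)
    (hint : IntegrableOn (fun r : ℝ => (r : ℂ) ^ (d - 1 - 2 * s)) I) :
    IntegrableOn (fun x => (cubicForm d x : ℂ) ^ (-s)) {x | ‖x‖ ∈ I} ∧
    ∫ x in {x | ‖x‖ ∈ I}, (cubicForm d x : ℂ) ^ (-s)
      = sphereIntegral d s * ∫ r in I, (r : ℂ) ^ (d - 1 - 2 * s) := by
  have : NeZero d := ⟨by omega⟩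
  set S : Set (Fin d → ℝ) := {x | ‖x‖ ∈ I} with hS
  have hSm : MeasurableSet S := measurable_norm hI
  set g : ℝ → ℂ := I.indicator fun r => (r : ℂ) ^ (-2 * s) with hg
  set F : (Fin d → ℝ) → ℂ := S.indicator fun x => (cubicForm d x : ℂ) ^ (-s) with hF
  set G : Metric.sphere (0 : Fin d → ℝ) 1 × Set.Ioi (0 : ℝ) → ℂ :=
    fun p => (cubicForm d p.1 : ℂ) ^ (-s) * g p.2 with hG
  have hFG : ∀ x : ({0}ᶜ : Set (Fin d → ℝ)),
      F x = G (homeomorphUnitSphereProd (Fin d → ℝ) x) := by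
    rintro ⟨x, hx⟩
    have hx' : x ≠ 0 := hx
    by_cases hxI : ‖x‖ ∈ I
    · have hxS : x ∈ S := hxI
      simp only [hF, hG, hg, Set.indicator_of_mem hxS, homeomorphUnitSphereProd_apply_snd_coe,
        homeomorphUnitSphereProd_apply_fst_coe, Set.indicator_of_mem hxI]
      exact cubicForm_cpow_eq_polar s hx'
    · have hxS : x ∉ S := hxI
      simp only [hF, hG, hg, Set.indicator_of_notMem hxS, homeomorphUnitSphereProd_apply_snd_coe,
        Set.indicator_of_notMem hxI, mul_zero]
  have hrad : (fun r : ℝ => (r : ℂ) ^ (d - 1) * g r)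
      = I.indicator fun r : ℝ => (r : ℂ) ^ (d - 1 - 2 * s) := by
    funext r
    by_cases hr : r ∈ I
    · have hr0 : (r : ℂ) ≠ 0 := by exact_mod_cast (hI0 hr).ne'
      simp only [hg, Set.indicator_of_mem hr]
      rw [← Complex.cpow_natCast, ← Complex.cpow_add _ _ hr0, Nat.cast_sub hd]
      push_cast
      ring_nf
    · simp [hg, Set.indicator_of_notMem hr]
  have hpol := (volume : Measure (Fin d → ℝ)).measurePreserving_homeomorphUnitSphereProd
  rw [Module.finrank_fin_fun] at hpol
  have hgint : Integrable (fun r : Set.Ioi (0 : ℝ) => g r) (Measure.volumeIoiPow (d - 1)) := by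
    rw [integrable_volumeIoiPow_iff, hrad]
    exact (hint.integrable_indicator hI).integrableOn
  have hGint : Integrable G ((volume : Measure (Fin d → ℝ)).toSphere.prod
      (Measure.volumeIoiPow (d - 1))) :=
    (integrable_sphere_cubicForm_cpow s).mul_prod hgint
  constructor
  · rw [← integrable_indicator_iff hSm, ← restrict_compl_singleton (μ := volume) 0, ← IntegrableOn,
      integrableOn_iff_comap_subtypeVal (measurableSet_singleton _).compl]
    refine ((hpol.integrable_comp_emb
      (Homeomorph.measurableEmbedding _)).mpr hGint).congr (ae_of_all _ fun x => ?_)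
    exact (hFG x).symm
  · rw [← integral_indicator hSm]
    calc ∫ x, F x = ∫ x : ({0}ᶜ : Set (Fin d → ℝ)), F x 
          ∂((volume : Measure (Fin d → ℝ)).comap Subtype.val) := by
          rw [integral_subtype_comap (measurableSet_singleton _).compl F,
            restrict_compl_singleton]
      _ = ∫ p, G p ∂((volume : Measure (Fin d → ℝ)).toSphere.prod
          (Measure.volumeIoiPow (d - 1))) := by
          simp_rw [hFG]
          exact hpol.integral_comp (Homeomorph.measurableEmbedding _) G
      _ = sphereIntegral d s * ∫ r : Set.Ioi (0 : ℝ), g r ∂(Measure.volumeIoiPow (d - 1)) :=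
          integral_prod_mul (fun ω : Metric.sphere (0 : Fin d → ℝ) 1 => (cubicForm d ω : ℂ) ^ (-s))
            (fun r : Set.Ioi (0 : ℝ) => g r)
      _ = _ := by
          rw [integral_volumeIoiPow, hrad, setIntegral_indicator hI,
            Set.inter_eq_self_of_subset_right hI0]

theorem integrableOn_integral_cube (hd : 1 ≤ d) {s : ℂ} (hs : s.re < (d : ℝ) / 2) (N : ℕ) :
    IntegrableOn (fun x => (cubicForm d x : ℂ) ^ (-s)) (cube d N) ∧
    ∫ x in cube d N, (cubicForm d x : ℂ) ^ (-s)
      = sphereIntegral d s * (((N : ℝ) + 1 / 2 : ℝ) : ℂ) ^ (d - 2 * s) / (d - 2 * s) := by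
  have : NeZero d := ⟨by omega⟩
  have hR : (0 : ℝ) ≤ (N : ℝ) + 1 / 2 := by positivity
  have hre : -1 < ((d : ℂ) - 1 - 2 * s).re := by
    simp
    linarith
  have hne : (d : ℂ) - 2 * s ≠ 0 := fun h => by
    have := congrArg Complex.re h
    simp at this
    linarith
  obtain ⟨h1, h2⟩ := integral_cubicForm_cpow_polar hd s
    (measurableSet_Ioc (a := (0 : ℝ)) (b := (N : ℝ) + 1 / 2)) (fun r hr => hr.1)
    ((intervalIntegrable_iff_integrableOn_Ioc_of_le hR).mp
      (intervalIntegral.intervalIntegrable_cpow' hre))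
  have hae : {x : Fin d → ℝ | ‖x‖ ∈ Set.Ioc (0 : ℝ) ((N : ℝ) + 1 / 2)} =ᵐ[volume] cube d N := by
    have : {x : Fin d → ℝ | ‖x‖ ∈ Set.Ioc (0 : ℝ) ((N : ℝ) + 1 / 2)} = cube d N \ {0} := by
      ext x
      rw [Set.mem_sdiff, mem_cube_iff, Set.mem_singleton_iff, ← ne_eq, ← norm_pos_iff,
        and_comm]
      rfl
    rw [this]
    exact sdiff_null_ae_eq_self (measure_singleton _)
  refine ⟨h1.congr_set_ae hae.symm, ?_⟩
  rw [← setIntegral_congr_set hae, h2, ← intervalIntegral.integral_of_le hR,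
    integral_cpow (Or.inl hre), show (d : ℂ) - 1 - 2 * s + 1 = d - 2 * s by ring,
    Complex.ofReal_zero, Complex.zero_cpow hne, sub_zero, mul_div_assoc]

/-- Without the central cell there is no singularity at the origin, so one formula serves on both
sides of `Re s = d/2`. This is what allows a comparison with the convergent series. -/
theorem integrableOn_integral_cube_sdiff (hd : 1 ≤ d) {s : ℂ} (hs : s ≠ (d : ℂ) / 2) (N : ℕ) :
    IntegrableOn (fun x => (cubicForm d x : ℂ) ^ (-s)) (cube d N \ cube d 0) ∧
    ∫ x in cube d N \ cube d 0, (cubicForm d x : ℂ) ^ (-s)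
      = sphereIntegral d s * ((((N : ℝ) + 1 / 2 : ℝ) : ℂ) ^ (d - 2 * s)
        - ((1 / 2 : ℝ) : ℂ) ^ (d - 2 * s)) / (d - 2 * s) := by
  have hR : (1 / 2 : ℝ) ≤ (N : ℝ) + 1 / 2 := by simp
  have h0 : (0 : ℝ) ∉ Set.uIcc (1 / 2 : ℝ) ((N : ℝ) + 1 / 2) := by
    rw [Set.uIcc_of_le hR]
    exact fun h => by norm_num at h
  have hne : (d : ℂ) - 1 - 2 * s ≠ -1 := fun h => hs (by linear_combination (-1 / 2) * h)
  obtain ⟨h1, h2⟩ := integral_cubicForm_cpow_polar hd s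
    (measurableSet_Ioc (a := (1 / 2 : ℝ)) (b := (N : ℝ) + 1 / 2))
    (fun r hr => lt_trans (by norm_num) hr.1)
    ((intervalIntegrable_iff_integrableOn_Ioc_of_le hR).mp
      (intervalIntegral.intervalIntegrable_cpow (Or.inr h0)))
  have heq : {x : Fin d → ℝ | ‖x‖ ∈ Set.Ioc (1 / 2 : ℝ) ((N : ℝ) + 1 / 2)}
      = cube d N \ cube d 0 := by
    ext x
    rw [Set.mem_sdiff, mem_cube_iff, mem_cube_iff, Nat.cast_zero, zero_add, not_le, and_comm]
    rfl
  rw [heq] at h1 h2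
  refine ⟨h1, ?_⟩
  rw [h2, ← intervalIntegral.integral_of_le hR, integral_cpow (Or.inr ⟨hne, h0⟩),
    show (d : ℂ) - 1 - 2 * s + 1 = d - 2 * s by ring, mul_div_assoc]

/-! ### Tiling of the cube minus its central cell. -/

/-- The nonzero integer vectors with coordinates between `-N` and `N`. -/
noncomputable def puncturedBox (d N : ℕ) : Finset (Fin d → ℤ) :=
  (Fintype.piFinset fun _ : Fin d => Finset.Icc (-(N : ℤ)) (N : ℤ)).erase 0

theorem integral_cell_eq (f : (Fin d → ℝ) → ℂ) (n : Fin d → ℤ) :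
    ∫ x in Set.univ.pi fun i => Set.Ioc ((n i : ℝ) - 1 / 2) (n i + 1 / 2), f x
      = ∫ h in cube d 0, f (intVec n + h) := by
  have hae : (Set.univ.pi fun i => Set.Ioc ((n i : ℝ) - 1 / 2) (n i + 1 / 2))
      =ᵐ[(volume : Measure (Fin d → ℝ))]
        Set.Icc (fun i => (n i : ℝ) - 1 / 2) (fun i => n i + 1 / 2) :=
    Measure.univ_pi_Ioc_ae_eq_Icc
  have hpre : (fun h => intVec n + h) ⁻¹'
      (Set.Icc (fun i => (n i : ℝ) - 1 / 2) (fun i => n i + 1 / 2)) = cube d 0 := by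
    ext h
    simp only [cube, Set.mem_preimage, Set.mem_Icc, Pi.le_def, ← forall_and, Pi.add_apply, intVec]
    refine forall_congr' fun i => ?_
    constructor <;> rintro ⟨h1, h2⟩ <;> constructor <;> push_cast at * <;> linarith
  rw [setIntegral_congr_set hae, ← hpre,
    (measurePreserving_add_left volume (intVec n)).setIntegral_preimage_emb
      (measurableEmbedding_addLeft (intVec n))]

theorem iUnion_cells (N : ℕ) :
    (⋃ n ∈ puncturedBox d N, Set.univ.pi fun i => Set.Ioc ((n i : ℝ) - 1 / 2) (n i + 1 / 2))
      = (Set.univ.pi fun _ => Set.Ioc (-(N : ℝ) - 1 / 2) (N + 1 / 2)) \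
        (Set.univ.pi fun _ : Fin d => Set.Ioc (-((0 : ℕ) : ℝ) - 1 / 2) ((0 : ℕ) + 1 / 2)) := by
  ext x
  simp only [Set.mem_iUnion, Set.mem_univ_pi, Set.mem_Ioc, exists_prop, Set.mem_sdiff,
    puncturedBox, Finset.mem_erase, Fintype.mem_piFinset, Finset.mem_Icc]
  constructor
  · rintro ⟨n, ⟨hn0, hn⟩, hx⟩
    refine ⟨fun i => ?_, fun h => hn0 (funext fun i => ?_)⟩
    · have h1 : -(N : ℝ) ≤ n i := by exact_mod_cast (hn i).1
      have h2 : (n i : ℝ) ≤ N := by exact_mod_cast (hn i).2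
      constructor <;> linarith [hx i]
    · have h1 := h i
      have h2 := hx i
      push_cast at h1
      have h3 : (n i : ℝ) < 1 := by linarith
      have h4 : (-1 : ℝ) < n i := by linarith
      have h5 : n i < 1 := by exact_mod_cast h3
      have h6 : -1 < n i := by exact_mod_cast h4
      simp only [Pi.zero_apply]
      omega
  · rintro ⟨hx, hx0⟩
    have hc : ∀ i, (⌈x i - 1 / 2⌉ : ℝ) - 1 / 2 < x i ∧ x i ≤ ⌈x i - 1 / 2⌉ + 1 / 2 := fun i =>
      ⟨by linarith [Int.ceil_lt_add_one (x i - 1 / 2)], by linarith [Int.le_ceil (x i - 1 / 2)]⟩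
    -- Cells are open on the left and closed on the right, so the centre of the cell containing `x`
    -- is found by this rounding, with ties going down.
    refine ⟨fun i => ⌈x i - 1 / 2⌉, ⟨fun h0 => hx0 fun i => ?_, fun i => ?_⟩, hc⟩
    · have h1 : (⌈x i - 1 / 2⌉ : ℝ) = 0 := by exact_mod_cast congrFun h0 i
      have h2 := hc i
      rw [h1] at h2
      push_cast
      constructor <;> linarith
    · have h1 := hx i
      constructor
      · have h2 : (-(N : ℤ) - 1 : ℤ) < ⌈x i - 1 / 2⌉ := by
          rw [Int.lt_ceil]
          push_cast
          linarith
        dsimp only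
        omega
      · rw [Int.ceil_le]
        push_cast
        linarith

theorem pairwise_disjoint_cells (d : ℕ) :
    Pairwise (Function.onFun Disjoint fun n : Fin d → ℤ =>
      Set.univ.pi fun i => Set.Ioc ((n i : ℝ) - 1 / 2) (n i + 1 / 2)) := by
  intro m n hmn
  refine Set.disjoint_left.mpr fun x hm hn => hmn (funext fun i => ?_)
  have h1 := hm i trivial
  have h2 := hn i trivial
  have h3 : (m i : ℝ) < n i + 1 := by linarith [h1.1, h2.2]
  have h4 : (n i : ℝ) < m i + 1 := by linarith [h1.2, h2.1]
  have h5 : m i < n i + 1 := by exact_mod_cast h3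
  have h6 : n i < m i + 1 := by exact_mod_cast h4
  omega

theorem sum_integral_cells {f : (Fin d → ℝ) → ℂ} {N : ℕ}
    (hf : IntegrableOn f (cube d N \ cube d 0)) :
    ∑ n ∈ puncturedBox d N, ∫ h in cube d 0, f (intVec n + h)
      = ∫ x in cube d N \ cube d 0, f x := by
  have hae : (⋃ n ∈ puncturedBox d N,
      Set.univ.pi fun i => Set.Ioc ((n i : ℝ) - 1 / 2) (n i + 1 / 2))
      =ᵐ[(volume : Measure (Fin d → ℝ))] (cube d N \ cube d 0 : Set (Fin d → ℝ)) := by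
    rw [iUnion_cells]
    exact ae_eq_set_sdiff Measure.univ_pi_Ioc_ae_eq_Icc Measure.univ_pi_Ioc_ae_eq_Icc
  have hf' := hf.congr_set_ae hae
  rw [← setIntegral_congr_set hae, integral_biUnion_finset]
  · exact Finset.sum_congr rfl fun n _ => (integral_cell_eq f n).symm
  · exact fun n _ => MeasurableSet.univ_pi fun i => measurableSet_Ioc
  · exact (pairwise_disjoint_cells d).set_pairwise _
  · exact fun n hn => hf'.mono_set (Set.subset_biUnion_of_mem (u := fun n : Fin d → ℤ =>
      Set.univ.pi fun i => Set.Ioc ((n i : ℝ) - 1 / 2) (n i + 1 / 2)) hn)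

/-! ### Theta function and continuation of the Epstein zeta function. -/

theorem hasSum_prod_pi_pow {ι : Type*} {a : ι → ℝ} {S : ℝ} (h0 : ∀ i, 0 ≤ a i) (ha : HasSum a S)
    (d : ℕ) : HasSum (fun n : Fin d → ι => ∏ i, a (n i)) (S ^ d) := by
  induction d with
  | zero => simp
  | succ d ih =>
    let e : ι × (Fin d → ι) ≃ (Fin (d + 1) → ι) := Fin.consEquiv fun _ => ι
    have hs : Summable fun p : ι × (Fin d → ι) => a p.1 * ∏ i, a (p.2 i) :=
      Summable.mul_of_nonneg (f := a) (g := fun n : Fin d → ι => ∏ i, a (n i)) ha.summable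
        ih.summable (Pi.le_def.mpr h0)
        (Pi.le_def.mpr fun n => Finset.prod_nonneg fun i _ => h0 (n i))
    have h : HasSum (fun p : ι × (Fin d → ι) => a p.1 * ∏ i, a (p.2 i)) (S * S ^ d) :=
      HasSum.mul (f := a) (g := fun n : Fin d → ι => ∏ i, a (n i)) ha ih hs
    have he : (fun n : Fin (d + 1) → ι => ∏ i, a (n i)) ∘ e
        = fun p => a p.1 * ∏ i, a (p.2 i) := by
      funext p
      simp [e, Fin.consEquiv, Fin.prod_univ_succ]
    rw [← e.hasSum_iff, pow_succ', he]
    exact h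

/-- The theta function `∑ exp (-π n² t)` of the lattice `ℤ`. -/
noncomputable def theta (t : ℝ) : ℝ := HurwitzZeta.evenKernel 0 t

theorem hasSum_theta {t : ℝ} (ht : 0 < t) :
    HasSum (fun n : ℤ => Real.exp (-Real.pi * (n : ℝ) ^ 2 * t)) (theta t) := by
  simpa [theta] using HurwitzZeta.hasSum_int_evenKernel 0 ht

theorem hasSum_theta_pow {t : ℝ} (ht : 0 < t) :
    HasSum (fun n : Fin d → ℤ => Real.exp (-Real.pi * cubicForm d (intVec n) * t))
      (theta t ^ d) := by
  have he : (fun n : Fin d → ℤ => Real.exp (-Real.pi * cubicForm d (intVec n) * t))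
      = fun n => ∏ i, Real.exp (-Real.pi * (n i : ℝ) ^ 2 * t) := by
    funext n
    rw [← Real.exp_sum, ← Finset.sum_mul, ← Finset.mul_sum]
    rfl
  rw [he]
  exact hasSum_prod_pi_pow (fun n => (Real.exp_pos _).le) (hasSum_theta ht) d

theorem hasSum_theta_pow_sub_one {t : ℝ} (ht : 0 < t) :
    HasSum (fun n : {n : Fin d → ℤ // n ≠ 0} =>
      Real.exp (-Real.pi * cubicForm d (intVec n.1) * t)) (theta t ^ d - 1) := by
  have h := hasSum_ite_sub_hasSum (hasSum_theta_pow (d := d) ht) 0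
  have h0 : Real.exp (-Real.pi * cubicForm d (intVec (0 : Fin d → ℤ)) * t) = 1 := by
    simp [cubicForm, intVec]
  rw [h0] at h
  have h2 := (hasSum_subtype_iff_of_support_subset (s := {n : Fin d → ℤ | n ≠ 0})
    (fun n hn => by
      by_contra h'
      simp only [Set.mem_ofPred_eq, not_not] at h'
      simp [h'] at hn)).mpr h
  have he : (fun n : {n : Fin d → ℤ // n ≠ 0} =>
      Real.exp (-Real.pi * cubicForm d (intVec n.1) * t))
      = (fun n => if n = 0 then 0 else Real.exp (-Real.pi * cubicForm d (intVec n) * t)) ∘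
        Subtype.val := by
    funext n
    simp [n.2]
  rw [he]
  exact h2

theorem theta_one_div {x : ℝ} (hx : 0 < x) : theta (1 / x) = x ^ (1 / 2 : ℝ) * theta x := by
  rw [theta, HurwitzZeta.evenKernel_functional_equation,
    ← HurwitzZeta.evenKernel_eq_cosKernel_of_zero, one_div_one_div, theta, one_div x,
    Real.inv_rpow hx.le, one_div, inv_inv]

/-- `θ - 1` decays exponentially, and `θ^d - 1` is `θ - 1` times a geometric sum that stays bounded
because `θ → 1`. -/
theorem theta_pow_sub_one_isBigO (d : ℕ) (r : ℝ) :
    (fun t : ℝ => theta t ^ d - 1) =O[atTop] fun t => t ^ r := by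
  obtain ⟨p, hp, h⟩ := HurwitzZeta.isBigO_atTop_evenKernel_sub 0
  simp only [if_true] at h
  have hexp : (fun t : ℝ => Real.exp (-p * t)) =O[atTop] fun t => t ^ r :=
    (isLittleO_exp_neg_mul_rpow_atTop hp r).isBigO
  have hlim : Tendsto (fun t : ℝ => theta t) atTop (𝓝 1) := by
    have h0 : Tendsto (fun t : ℝ => Real.exp (-p * t)) atTop (𝓝 0) :=
      Real.tendsto_exp_atBot.comp (tendsto_id.const_mul_atTop_of_neg (by linarith))
    simpa [theta] using (h.trans_tendsto h0).add_const 1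
  have hgeom : (fun t : ℝ => ∑ i ∈ Finset.range d, theta t ^ i) =O[atTop] fun _ => (1 : ℝ) :=
    (tendsto_finsetSum (Finset.range d) fun i _ => hlim.pow i).isBigO_one ℝ
  have := (h.trans hexp).mul hgeom
  simp only [mul_one] at this
  exact this.congr_left fun t => mul_geom_sum (theta t) d

/-- The functional equation of `theta ^ d`, as input for the theory of Mellin transforms. -/
noncomputable def thetaPair (d : ℕ) (hd : 1 ≤ d) : WeakFEPair ℂ :=
  have hint : LocallyIntegrableOn (fun t : ℝ => ((theta t ^ d : ℝ) : ℂ)) (Set.Ioi 0) :=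
    (Complex.continuous_ofReal.comp_continuousOn
      ((HurwitzZeta.continuousOn_evenKernel 0).pow d)).locallyIntegrableOn measurableSet_Ioi
  have hO : ∀ r : ℝ, (fun t : ℝ => ((theta t ^ d : ℝ) : ℂ) - 1) =O[atTop] (· ^ r) := fun r => by
    refine Asymptotics.IsBigO.of_norm_left (((theta_pow_sub_one_isBigO d r).norm_left).congr_left
      fun t => ?_)
    rw [← Complex.ofReal_one, ← Complex.ofReal_sub, Complex.norm_real]
  { f := fun t => ((theta t ^ d : ℝ) : ℂ)
    g := fun t => ((theta t ^ d : ℝ) : ℂ)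
    k := d / 2
    ε := 1
    f₀ := 1
    g₀ := 1
    hf_int := hint
    hg_int := hint
    hk := by
      have : (1 : ℝ) ≤ d := by exact_mod_cast hd
      linarith
    hε := one_ne_zero
    h_feq := fun x hx => by
      have hx0 : (0 : ℝ) < x := hx
      rw [theta_one_div hx0, mul_pow, ← Real.rpow_natCast (x ^ (1 / 2 : ℝ)),
        ← Real.rpow_mul hx0.le, one_mul, smul_eq_mul, ← Complex.ofReal_mul]
      ring_nf
    hf_top := hO
    hg_top := hO }

/-- The entire function `(s - d/2) α(s)`, where `α` is the Epstein zeta function of the cubic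
form. -/
noncomputable def epsteinEntire (d : ℕ) (hd : 1 ≤ d) (s : ℂ) : ℂ :=
  (Real.pi : ℂ) ^ s * ((s - d / 2) * ((thetaPair d hd).Λ₀ s * (Complex.Gamma s)⁻¹
    - (Complex.Gamma (s + 1))⁻¹) + (Complex.Gamma s)⁻¹)

/-- The Epstein zeta function of the cubic form. -/
noncomputable def epsteinZeta (d : ℕ) (hd : 1 ≤ d) (s : ℂ) : ℂ :=
  epsteinEntire d hd s / (s - d / 2)

theorem differentiable_epsteinEntire (hd : 1 ≤ d) : Differentiable ℂ (epsteinEntire d hd) := by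
  have h1 := (thetaPair d hd).differentiable_Λ₀
  have h2 := Complex.differentiable_one_div_Gamma
  have h3 : Differentiable ℂ fun s : ℂ => (Complex.Gamma (s + 1))⁻¹ :=
    h2.comp (differentiable_id.add_const 1)
  have h4 : Differentiable ℂ fun s : ℂ => (Real.pi : ℂ) ^ s :=
    differentiable_id.const_cpow (Or.inl (by exact_mod_cast Real.pi_ne_zero))
  unfold epsteinEntire
  fun_prop

/-- This is the residue of the zeta function at `d/2`, the source of the jump of the Wigner limit.
-/
theorem epsteinEntire_half_dim (hd : 1 ≤ d) :
    epsteinEntire d hd (d / 2) = (Real.pi : ℂ) ^ ((d : ℂ) / 2) / Complex.Gamma (d / 2) := by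
  simp [epsteinEntire, div_eq_mul_inv]

/-- `Λ` is `Λ₀ - 1/s - 1/(d/2 - s)`. Division by `Γ(s)` turns `1/s` into `1/Γ(s + 1)`, which removes
the pole at `0` and leaves at most the one at `d/2`. -/
theorem epsteinZeta_eq (hd : 1 ≤ d) {s : ℂ} (hs : (d : ℝ) / 2 < s.re) :
    epsteinZeta d hd s
      = (Real.pi : ℂ) ^ s / Complex.Gamma s * (thetaPair d hd).Λ s := by
  have hd0 : (0 : ℝ) ≤ d := by positivity
  have hs0 : s ≠ 0 := fun h => by
    rw [h] at hs
    simp at hs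
    linarith
  have hG : Complex.Gamma s ≠ 0 := Complex.Gamma_ne_zero_of_re_pos (by linarith)
  have hk : s - d / 2 ≠ 0 := fun h => by
    have := congrArg Complex.re h
    simp at this
    linarith
  have hk' : (d : ℂ) / 2 - s ≠ 0 := fun h => hk (by linear_combination -h)
  have hkk : (((thetaPair d hd).k : ℝ) : ℂ) = d / 2 := by simp [thetaPair]
  rw [WeakFEPair.Λ, hkk, epsteinZeta, epsteinEntire, Complex.Gamma_add_one s hs0]
  have e1 : (thetaPair d hd).f₀ = 1 := rfl
  have e2 : (thetaPair d hd).g₀ = 1 := rfl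
  have e3 : (thetaPair d hd).ε = 1 := rfl
  rw [e1, e2, e3, smul_eq_mul, smul_eq_mul]
  generalize (d : ℂ) / 2 = k at *
  rw [← neg_sub s k, div_neg]
  field_simp
  ring

/-- `Λ` is the Mellin transform of `θ^d - 1` in this half-plane. Integrating the theta series term
by term yields `π^(-s) Γ(s) Q(n)^(-s)`. -/
theorem hasSum_epsteinZeta (hd : 1 ≤ d) {s : ℂ} (hs : (d : ℝ) / 2 < s.re) :
    HasSum (fun n : {n : Fin d → ℤ // n ≠ 0} => (cubicForm d (intVec n.1) : ℂ) ^ (-s))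
      (epsteinZeta d hd s) := by
  have hd0 : (0 : ℝ) ≤ d := by positivity
  have hG : Complex.Gamma s ≠ 0 := Complex.Gamma_ne_zero_of_re_pos (by linarith)
  have hpi : (Real.pi : ℂ) ≠ 0 := by exact_mod_cast Real.pi_ne_zero
  have hM := (thetaPair d hd).hasMellin (s := s) hs
  have h := hasSum_mellin_pi_mul (a := fun _ : {n : Fin d → ℤ // n ≠ 0} => (1 : ℂ))
    (q := fun n => cubicForm d (intVec n.1))
    (F := fun t => (thetaPair d hd).f t - (thetaPair d hd).f₀) (s := s)
    (fun n => Or.inr (cubicForm_pos (intVec_ne_zero n.2))) (by linarith)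
    (fun t ht => by
      have := Complex.hasSum_ofReal.mpr (hasSum_theta_pow_sub_one (d := d) ht)
      simpa [thetaPair] using this)
    ((summable_cubicForm_intVec_rpow hs).congr fun n => by
      rw [Real.rpow_neg (cubicForm_nonneg _)]
      simp)
  rw [hM.2] at h
  rw [epsteinZeta_eq hd hs]
  convert! h.mul_left ((Real.pi : ℂ) ^ s / Complex.Gamma s) using 2 with n
  rw [Complex.cpow_neg, Complex.cpow_neg]
  have := (Complex.cpow_ne_zero_iff_of_exponent_ne_zero (x := (Real.pi : ℂ)) (y := s) (fun h => by
    rw [h] at hs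
    simp at hs
    linarith)).mpr hpi
  field_simp

theorem differentiableAt_epsteinZeta (hd : 1 ≤ d) {s : ℂ} (hs : s ≠ (d : ℂ) / 2) :
    DifferentiableAt ℂ (epsteinZeta d hd) s :=
  (differentiable_epsteinEntire hd s).div (by fun_prop) (sub_ne_zero.mpr hs)

theorem isEpsteinContinuation_epsteinZeta (hd : 1 ≤ d) :
    IsEpsteinContinuation (cubicForm d) (epsteinZeta d hd) where
  hasSum s hs := by
    simp_rw [one_div, ← Complex.cpow_neg]
    exact hasSum_epsteinZeta hd hs
  differentiableOn s hs := (differentiableAt_epsteinZeta hd hs).differentiableWithinAt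
  meromorphicAt :=
    ((differentiable_epsteinEntire hd).analyticAt _).meromorphicAt.div
      (by fun_prop : AnalyticAt ℂ (fun s : ℂ => s - d / 2) (d / 2)).meromorphicAt

/-! ### Cell errors summed over boxes, and their relation to the zeta function. -/

theorem tendsto_sum_puncturedBox {F : (Fin d → ℤ) → ℂ} {S : ℂ}
    (h : HasSum (fun n : {n : Fin d → ℤ // n ≠ 0} => F n.1) S) :
    Tendsto (fun N : ℕ => ∑ n ∈ puncturedBox d N, F n) atTop (𝓝 S) := by
  have h1 : HasSum ({n : Fin d → ℤ | n ≠ 0}.indicator F) S :=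
    (hasSum_subtype_iff_indicator (s := {n : Fin d → ℤ | n ≠ 0})).mp h
  have hbox : Tendsto (fun N : ℕ => Fintype.piFinset fun _ : Fin d =>
      Finset.Icc (-(N : ℤ)) (N : ℤ)) atTop atTop := by
    refine tendsto_atTop_finset_of_monotone (fun M N hMN => ?_) fun n => ?_
    · refine Fintype.piFinset_subset _ _ fun _ => Finset.Icc_subset_Icc ?_ ?_
      · simpa using hMN
      · simpa using hMN
    · refine ⟨∑ i, (n i).natAbs, ?_⟩
      simp only [Fintype.mem_piFinset, Finset.mem_Icc]
      intro i
      have := Finset.single_le_sum (f := fun i => (n i).natAbs) (fun i _ => Nat.zero_le _)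
        (Finset.mem_univ i)
      omega
  refine (h1.comp hbox).congr fun N => ?_
  rw [Function.comp_apply, puncturedBox,
    ← Finset.sum_erase _ (show {n : Fin d → ℤ | n ≠ 0}.indicator F 0 = 0 by simp)]
  refine Finset.sum_congr rfl fun n hn => ?_
  exact Set.indicator_of_mem (s := {n : Fin d → ℤ | n ≠ 0}) (Finset.ne_of_mem_erase hn) F

theorem alphaN_cubicForm (N : ℕ) (s : ℂ) :
    alphaN (cubicForm d) N s = ∑ n ∈ puncturedBox d N, (cubicForm d (intVec n) : ℂ) ^ (-s) := by
  simp_rw [Complex.cpow_neg, ← one_div]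
  rfl

theorem sum_cellError (hd : 1 ≤ d) {s : ℂ} (hs : s ≠ (d : ℂ) / 2) (N : ℕ) :
    ∑ n ∈ puncturedBox d N, cellError s (intVec n)
      = alphaN (cubicForm d) N s
        - sphereIntegral d s * ((((N : ℝ) + 1 / 2 : ℝ) : ℂ) ^ (d - 2 * s)
          - ((1 / 2 : ℝ) : ℂ) ^ (d - 2 * s)) / (d - 2 * s) := by
  obtain ⟨h1, h2⟩ := integrableOn_integral_cube_sdiff hd hs N
  rw [← h2, ← sum_integral_cells h1, alphaN_cubicForm, ← Finset.sum_sub_distrib]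
  rfl

theorem ne_half_dim_of_re_lt {s : ℂ} (hs : s.re < (d : ℝ) / 2) : s ≠ (d : ℂ) / 2 := fun h => by
  rw [h] at hs
  simp at hs

/-- The powers of `N + 1/2` in `β_N` and in the shell integral cancel, so apart from the cell errors
only the integral over the central cell survives, and it does not depend on `N`. -/
theorem sigmaN_cubicForm (hd : 1 ≤ d) {s : ℂ} (hs : s.re < (d : ℝ) / 2) (N : ℕ) :
    sigmaN (cubicForm d) N s = ∑ n ∈ puncturedBox d N, cellError s (intVec n)
      - sphereIntegral d s * ((1 / 2 : ℝ) : ℂ) ^ (d - 2 * s) / (d - 2 * s) := by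
  have hb : betaN (cubicForm d) N s
      = sphereIntegral d s * (((N : ℝ) + 1 / 2 : ℝ) : ℂ) ^ (d - 2 * s) / (d - 2 * s) := by
    rw [← (integrableOn_integral_cube hd hs N).2, betaN]
    simp_rw [Complex.cpow_neg, ← one_div]
  rw [sum_cellError hd (ne_half_dim_of_re_lt hs), sigmaN, hb]
  ring

theorem hasSum_cellError (hd : 1 ≤ d) {s : ℂ} (hs : (d : ℝ) / 2 - 1 < s.re) :
    HasSum (fun n : {n : Fin d → ℤ // n ≠ 0} => cellError s (intVec n.1))
      (remainderSum d s - 1 / 6 * s * epsteinEntire d hd (s + 1)) := by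
  have hs1 : (d : ℝ) / 2 < (s + 1).re := by
    simp
    linarith
  have hne : s + 1 - d / 2 ≠ 0 := fun h => by
    have := congrArg Complex.re h
    simp at this hs1
    linarith
  have h := ((summable_cellRemainder hd (s := s) (by linarith)).hasSum).sub
    ((hasSum_epsteinZeta hd hs1).mul_left (1 / 6 * s * (s + 1 - d / 2)))
  have he : 1 / 6 * s * (s + 1 - d / 2) * epsteinZeta d hd (s + 1)
      = 1 / 6 * s * epsteinEntire d hd (s + 1) := by
    rw [epsteinZeta, mul_assoc (1 / 6 * s), mul_div_cancel₀ _ hne]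
  rw [he] at h
  simpa [cellRemainder, remainderSum] using h

/-- The coefficient `s + 1 - d/2` is zero here, so the second-order correction vanishes in every
cell before summation. No term corresponding to the residue appears, unlike in the limit from the
strip. -/
theorem hasSum_cellError_half_dim_sub_one (hd : 1 ≤ d) :
    HasSum (fun n : {n : Fin d → ℤ // n ≠ 0} => cellError ((d : ℂ) / 2 - 1) (intVec n.1))
      (remainderSum d (d / 2 - 1)) := by
  have h := (summable_cellRemainder hd (s := (d : ℂ) / 2 - 1) (by simp)).hasSum
  simpa [cellRemainder, remainderSum] using h

/-- Let `N → ∞` in `sum_cellError`: on this side of `d/2` the outer boundary term `(N + 1/2)^(d -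
2s)` tends to `0`. What remains has the form of the Wigner limit in the strip. -/
theorem epsteinZeta_eq_of_half_dim_lt (hd : 1 ≤ d) {s : ℂ} (hs : (d : ℝ) / 2 < s.re) :
    epsteinZeta d hd s = remainderSum d s - 1 / 6 * s * epsteinEntire d hd (s + 1)
      - sphereIntegral d s * ((1 / 2 : ℝ) : ℂ) ^ (d - 2 * s) / (d - 2 * s) := by
  have hne : s ≠ (d : ℂ) / 2 := fun h => by
    rw [h] at hs
    simp at hs
  have hα := tendsto_sum_puncturedBox (F := fun n => (cubicForm d (intVec n) : ℂ) ^ (-s))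
    (hasSum_epsteinZeta hd hs)
  have he := tendsto_sum_puncturedBox (F := fun n => cellError s (intVec n))
    (hasSum_cellError hd (by linarith))
  have hR : Tendsto (fun N : ℕ => (((N : ℝ) + 1 / 2 : ℝ) : ℂ) ^ ((d : ℂ) - 2 * s)) atTop (𝓝 0) := by
    rw [tendsto_zero_iff_norm_tendsto_zero]
    have hlim : Tendsto (fun N : ℕ => ((N : ℝ) + 1 / 2) ^ (-(2 * s.re - d))) atTop (𝓝 0) :=
      (tendsto_rpow_neg_atTop (by linarith)).comp
        (tendsto_atTop_add_const_right _ _ tendsto_natCast_atTop_atTop)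
    refine hlim.congr fun N => ?_
    rw [Complex.norm_cpow_eq_rpow_re_of_pos (by positivity)]
    simp
  have h := he.add (((hR.sub_const (((1 / 2 : ℝ) : ℂ) ^ ((d : ℂ) - 2 * s))).const_mul
    (sphereIntegral d s)).div_const ((d : ℂ) - 2 * s))
  rw [tendsto_nhds_unique hα (h.congr fun N => ?_)]
  · ring
  · rw [sum_cellError hd hne, alphaN_cubicForm]
    ring

/-- Multiplication by `s - d/2` clears the pole, so both sides are analytic on the whole half-plane.
They agree near `d/2 + 1`, hence everywhere by the identity theorem. -/
theorem epsteinEntire_eq (hd : 1 ≤ d) {s : ℂ} (hs : (d : ℝ) / 2 - 2 < s.re) :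
    epsteinEntire d hd s = (s - d / 2) * (remainderSum d s - 1 / 6 * s * epsteinEntire d hd (s + 1))
      + sphereIntegral d s * ((1 / 2 : ℝ) : ℂ) ^ (d - 2 * s) / 2 := by
  have hopen : ∀ c : ℝ, IsOpen {w : ℂ | c < w.re} := fun c =>
    isOpen_lt continuous_const Complex.continuous_re
  have hl : AnalyticOnNhd ℂ (epsteinEntire d hd) {w : ℂ | (d : ℝ) / 2 - 2 < w.re} := fun w _ =>
    (differentiable_epsteinEntire hd).analyticAt w
  have hr : AnalyticOnNhd ℂ (fun s => (s - d / 2) * (remainderSum d s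
      - 1 / 6 * s * epsteinEntire d hd (s + 1))
      + sphereIntegral d s * ((1 / 2 : ℝ) : ℂ) ^ (d - 2 * s) / 2)
      {w : ℂ | (d : ℝ) / 2 - 2 < w.re} := by
    refine DifferentiableOn.analyticOnNhd (fun w hw => ?_) (hopen _)
    have h1 := differentiableAt_remainderSum hd hw
    have h2 : Differentiable ℂ fun s => epsteinEntire d hd (s + 1) :=
      (differentiable_epsteinEntire hd).comp (differentiable_id.add_const 1)
    have h3 := differentiable_sphereIntegral d
    have h4 : Differentiable ℂ fun s : ℂ => ((1 / 2 : ℝ) : ℂ) ^ ((d : ℂ) - 2 * s) :=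
      Differentiable.const_cpow (by fun_prop) (Or.inl (by norm_num))
    refine DifferentiableAt.differentiableWithinAt ?_
    have h2' := h2 w
    have h3' := h3 w
    have h4' := h4 w
    fun_prop
  refine hl.eqOn_of_preconnected_of_eventuallyEq hr (z₀ := (d : ℂ) / 2 + 1)
    (convex_halfSpace_re_gt _).isPreconnected ?_ ?_ hs
  · simp
    linarith
  · filter_upwards [(hopen ((d : ℝ) / 2)).mem_nhds (by simp)] with w hw
    have hw' : (d : ℝ) / 2 < w.re := hw
    have hne : w - d / 2 ≠ 0 := fun h => by
      have := congrArg Complex.re h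
      simp at this
      linarith
    have h := epsteinZeta_eq_of_half_dim_lt hd hw'
    rw [epsteinZeta, div_eq_iff hne] at h
    generalize ((1 / 2 : ℝ) : ℂ) ^ ((d : ℂ) - 2 * w) = c at *
    rw [h, show (d : ℂ) - 2 * w = -2 * (w - d / 2) by ring]
    generalize w - (d : ℂ) / 2 = u at *
    field_simp
    ring

theorem epsteinZeta_eq_of_re_lt (hd : 1 ≤ d) {s : ℂ} (hs : (d : ℝ) / 2 - 2 < s.re)
    (hs' : s.re < (d : ℝ) / 2) :
    epsteinZeta d hd s = remainderSum d s - 1 / 6 * s * epsteinEntire d hd (s + 1)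
      - sphereIntegral d s * ((1 / 2 : ℝ) : ℂ) ^ (d - 2 * s) / (d - 2 * s) := by
  have hne : s - d / 2 ≠ 0 := sub_ne_zero.mpr (ne_half_dim_of_re_lt hs')
  rw [epsteinZeta, epsteinEntire_eq hd hs]
  have e : (d : ℂ) - 2 * s = -2 * (s - d / 2) := by ring
  generalize ((1 / 2 : ℝ) : ℂ) ^ ((d : ℂ) - 2 * s) = c
  rw [e]
  generalize s - (d : ℂ) / 2 = u at *
  field_simp
  ring

/-! ### The Wigner limits and the jump. -/

theorem tendsto_sigmaN_strip (hd : 1 ≤ d) {s : ℂ} (hs : s ∈ strip d) :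
    Tendsto (fun N : ℕ => sigmaN (cubicForm d) N s) atTop (𝓝 (epsteinZeta d hd s)) := by
  simp_rw [sigmaN_cubicForm hd hs.2]
  rw [epsteinZeta_eq_of_re_lt hd (by linarith [hs.1]) hs.2]
  exact (tendsto_sum_puncturedBox (F := fun n => cellError s (intVec n))
    (hasSum_cellError hd hs.1)).sub_const _

theorem tendsto_sigmaN_half_dim_sub_one (hd : 1 ≤ d) :
    Tendsto (fun N : ℕ => sigmaN (cubicForm d) N ((d : ℂ) / 2 - 1)) atTop
      (𝓝 (epsteinZeta d hd (d / 2 - 1)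
        + 1 / 6 * ((Real.pi : ℂ) ^ ((d : ℂ) / 2) / Complex.Gamma ((d : ℂ) / 2 - 1)))) := by
  have hre : ((d : ℂ) / 2 - 1).re = (d : ℝ) / 2 - 1 := by simp
  simp_rw [sigmaN_cubicForm hd (s := (d : ℂ) / 2 - 1) (by rw [hre]; linarith)]
  -- This form of the functional equation of `1/Γ` also holds at `0`, so `d = 2` needs no separate
  -- case.
  have hG := Complex.one_div_Gamma_eq_self_mul_one_div_Gamma_add_one ((d : ℂ) / 2 - 1)
  rw [sub_add_cancel] at hG
  have he := epsteinZeta_eq_of_re_lt hd (s := (d : ℂ) / 2 - 1) (by rw [hre]; linarith)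
    (by rw [hre]; linarith)
  rw [sub_add_cancel, epsteinEntire_half_dim] at he
  convert (tendsto_sum_puncturedBox (F := fun n => cellError ((d : ℂ) / 2 - 1) (intVec n))
    (hasSum_cellError_half_dim_sub_one hd)).sub_const _ using 2
  rw [he, div_eq_mul_inv _ (Complex.Gamma ((d : ℂ) / 2 - 1)), hG]
  ring

theorem half_dim_sub_one_add_mem_strip {ε : ℝ} (h0 : 0 < ε) (h1 : ε < 1) :
    (d : ℂ) / 2 - 1 + (ε : ℂ) ∈ strip d := by
  simp only [strip, Set.mem_ofPred_eq]
  simp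
  constructor <;> linarith

theorem eventually_half_dim_sub_one_add_mem_strip (d : ℕ) :
    ∀ᶠ ε : ℝ in 𝓝[>] 0, (d : ℂ) / 2 - 1 + (ε : ℂ) ∈ strip d := by
  filter_upwards [Ioo_mem_nhdsGT (show (0 : ℝ) < 1 from one_pos)] with ε hε
  exact half_dim_sub_one_add_mem_strip hε.1 hε.2

theorem tendsto_half_dim_sub_one_add (d : ℕ) :
    Tendsto (fun ε : ℝ => (d : ℂ) / 2 - 1 + (ε : ℂ)) (𝓝[>] 0) (𝓝 ((d : ℂ) / 2 - 1)) := by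
  have : Continuous fun ε : ℝ => (d : ℂ) / 2 - 1 + (ε : ℂ) := by fun_prop
  simpa using (this.tendsto 0).mono_left nhdsWithin_le_nhds

end Wigner

/-- At `d = 2` the quotient by `Γ(d/2 - 1) = Γ(0)` is `0` in Lean, in agreement with the zero of
the entire function `1/Γ` at `0`. -/
theorem theorem4p2 (d : ℕ) (hd : 1 ≤ d) :
    -- the integrals defining `β_N(s)` converge absolutely for `Re s < d/2`
    (∀ (N : ℕ) (s : ℂ), s.re < (d : ℝ) / 2 →
      IntegrableOn (fun x => 1 / (Wigner.cubicForm d x : ℂ) ^ s) (Wigner.cube d N)) ∧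
    -- the Wigner limit exists in the strip and at `d/2 - 1`
    (∀ s ∈ insert ((d : ℂ) / 2 - 1) (Wigner.strip d),
      Tendsto (fun N : ℕ => Wigner.sigmaN (Wigner.cubicForm d) N s) atTop
        (𝓝 (Wigner.sigma (Wigner.cubicForm d) s))) ∧
    -- comparison with the analytic continuation `α` of the Epstein zeta function
    (∃ α : ℂ → ℂ, Wigner.IsEpsteinContinuation (Wigner.cubicForm d) α ∧
      (∀ s ∈ Wigner.strip d, Wigner.sigma (Wigner.cubicForm d) s = α s) ∧
      Wigner.sigma (Wigner.cubicForm d) ((d : ℂ) / 2 - 1)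
          - 1 / 6 * ((Real.pi : ℂ) ^ ((d : ℂ) / 2) / Complex.Gamma ((d : ℂ) / 2 - 1))
        = α ((d : ℂ) / 2 - 1) ∧
      Tendsto (fun ε : ℝ => Wigner.sigma (Wigner.cubicForm d) ((d : ℂ) / 2 - 1 + (ε : ℂ)))
        (𝓝[>] 0) (𝓝 (α ((d : ℂ) / 2 - 1)))) ∧
    -- discontinuity at `d/2 - 1` in dimension at least three
    (3 ≤ d → ¬ ContinuousWithinAt (Wigner.sigma (Wigner.cubicForm d))
      (insert ((d : ℂ) / 2 - 1) (Wigner.strip d)) ((d : ℂ) / 2 - 1)) := by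
  have hstrip : ∀ s ∈ Wigner.strip d,
      Wigner.sigma (Wigner.cubicForm d) s = Wigner.epsteinZeta d hd s := fun s hs =>
    (Wigner.tendsto_sigmaN_strip hd hs).limUnder_eq
  have hpoint : Wigner.sigma (Wigner.cubicForm d) ((d : ℂ) / 2 - 1)
      = Wigner.epsteinZeta d hd (d / 2 - 1)
        + 1 / 6 * ((Real.pi : ℂ) ^ ((d : ℂ) / 2) / Complex.Gamma ((d : ℂ) / 2 - 1)) :=
    (Wigner.tendsto_sigmaN_half_dim_sub_one hd).limUnder_eq
  have hcont : Tendsto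
      (fun ε : ℝ => Wigner.sigma (Wigner.cubicForm d) ((d : ℂ) / 2 - 1 + (ε : ℂ)))
      (𝓝[>] 0) (𝓝 (Wigner.epsteinZeta d hd ((d : ℂ) / 2 - 1))) := by
    have hα := (Wigner.differentiableAt_epsteinZeta hd (s := (d : ℂ) / 2 - 1)
      (fun h => by simp at h)).continuousAt.tendsto
    refine (hα.comp (Wigner.tendsto_half_dim_sub_one_add d)).congr' ?_
    filter_upwards [Wigner.eventually_half_dim_sub_one_add_mem_strip d] with ε hε
    exact (hstrip _ hε).symm
  refine ⟨fun N s hs => ?_, fun s hs => ?_, ⟨Wigner.epsteinZeta d hd,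
    Wigner.isEpsteinContinuation_epsteinZeta hd, hstrip, ?_, hcont⟩, fun h3 hc => ?_⟩
  · simpa only [Complex.cpow_neg, one_div] using (Wigner.integrableOn_integral_cube hd hs N).1
  · rcases hs with rfl | hs
    · rw [hpoint]
      exact Wigner.tendsto_sigmaN_half_dim_sub_one hd
    · rw [hstrip s hs]
      exact Wigner.tendsto_sigmaN_strip hd hs
  · rw [hpoint, add_sub_cancel_right]
  · have hin : Tendsto (fun ε : ℝ => (d : ℂ) / 2 - 1 + (ε : ℂ)) (𝓝[>] 0)
        (𝓝[insert ((d : ℂ) / 2 - 1) (Wigner.strip d)] ((d : ℂ) / 2 - 1)) :=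
      tendsto_nhdsWithin_iff.mpr ⟨Wigner.tendsto_half_dim_sub_one_add d,
        (Wigner.eventually_half_dim_sub_one_add_mem_strip d).mono fun _ h => Or.inr h⟩
    -- Continuity would force the value at the point to equal the limit along the real direction
    -- inside the strip, so the jump would be zero. For `d ≥ 3`, `Γ(d/2 - 1)` is an honest nonzero
    -- value and the jump is not.
    have heq := tendsto_nhds_unique (hc.tendsto.comp hin) hcont
    rw [hpoint, add_eq_left] at heq
    have h3' : (3 : ℝ) ≤ d := by exact_mod_cast h3
    have hG : Complex.Gamma ((d : ℂ) / 2 - 1) ≠ 0 :=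
      Complex.Gamma_ne_zero_of_re_pos (by simp; linarith)
    have hpi : (Real.pi : ℂ) ^ ((d : ℂ) / 2) ≠ 0 := by
      rw [Complex.cpow_def_of_ne_zero (by exact_mod_cast Real.pi_ne_zero)]
      exact Complex.exp_ne_zero _
    exact mul_ne_zero (by norm_num) (div_ne_zero hpi hG) heq
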